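/- Let $F$ be a field of characteristic different from $2$, let $X$ be an abelian group, and let $D$ be the diagonalizable group over $F$ with character group $X$, so $F[D]=FX$. Let $g\in X$ with $g^2=1$, and let $x\in \mathrm{Lie}(D)$, i.e. $x:X\to F$ is a function with $x(h_1h_2)=x(h_1)+x(h_2)$. Let $D_{g,x}$ be the affine supergroup with coordinate Hopf superalgebra $F[D_{g,x}]=FX\oplus (FX)z$, where $z$ is odd, $z^2=0$, \[\Delta(h)=h\otimes h+x(h)\,hz\otimes hgz,\quad \Delta(z)=1\otimes z+z\otimes g,\quad \epsilon(h)=1,\ \epsilon(z)=0,\quad s(h)=h^{-1},\ s(z)=-g^{-1}z\qquad(h\in X).\] Let $D'\subseteq D$ be the kernel of the character $g:D\to\mu_2$, i.e. $F[D']=FX/FX(g-1)$; it is a purely even subsupergroup of $D_{g,x}$ via $h\mapsto h$, $z\mapsto 0$. For an affine supergroup $G$ and a finite-dimensional $G$-supermodule $V$ (a right $F[G]$-supercomodule) with homogeneous basis $v_i$ and coaction $\tau(v_i)=\sum_k v_k\otimes a_{ki}$, let $F[V]$ be the polynomial superalgebra freely generated by the dual basis $x_i$ (of parity $|x_i|=|v_i|$),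 with the coaction that is the superalgebra homomorphism $\tau:F[V]\to F[V]\otimes F[G]$ given by $\tau(x_i)=\sum_k x_k\otimes(-1)^{|v_k|(|v_i|+|v_k|)}s(a_{ik})$. Put $F[V]^G=\{f:\tau(f)=f\otimes 1\}$ and $M_{G,V}=\min\{d>0: F[V]^G_d\neq 0\}$, with $M_{G,V}=\infty$ if there is no such $d$. Let $V$ be a finite-dimensional $D_{g,x}$-supermodule. Then \[M_{D',V}\le M_{D_{g,x},V}\le 2M_{D',V}\] in each of the following two cases: (a) $D$ is connected (and $V$ is arbitrary); (b) $D$ is not necessarily connected, and $V^*\simeq L(h_1)\oplus\dots\oplus L(h_s)$ for some $s\ge 0$ and $h_1,\dots,h_s\in X$, that is, $V^*$ has a basis $f_{j,0}$ (even), $f_{j,1}$ (odd), $1\le j\le s$, such that $\tau(f_{j,0})=f_{j,0}\otimes h_j+x(h_j)f_{j,1}\otimes h_jgz$ and $\tau(f_{j,1})=f_{j,0}\otimes h_jz+f_{j,1}\otimes h_jg$. -/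

import Mathlib

open scoped TensorProduct DirectSum

set_option linter.unusedSimpArgs false

noncomputable section

/-- A Hopf superalgebra over `F` on a given algebra and coalgebra `A`: a `ℤ/2`-grading for which `A`
is supercommutative, the counit and the comultiplication are homomorphisms of superalgebras (the
target `A ⊗ A` of the latter carries the multiplication
`(a ⊗ b)(c ⊗ d) = (-1)^{|b||c|} ac ⊗ bd`), together with a bijective antipode `s` which is an
endomorphism of superalgebras with `Δ s = t (s ⊗ s) Δ`, where `t` is the supersymmetry
`a ⊗ b ↦ (-1)^{|a||b|} b ⊗ a`. -/
structure HopfSuperalgebra (F A : Type*) [Field F] [Ring A] [Algebra F A] [Coalgebra F A] where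
  gr : ZMod 2 → Submodule F A
  gradedAlgebra : GradedAlgebra gr
  supercomm : ∀ (i j : ZMod 2) (a b : A), a ∈ gr i → b ∈ gr j →
    a * b = ((-1 : ℤˣ) ^ (i * j)) • (b * a)
  counit_one : Coalgebra.counit (R := F) (1 : A) = 1
  counit_mul : ∀ a b : A, Coalgebra.counit (R := F) (a * b) =
    Coalgebra.counit (R := F) a * Coalgebra.counit (R := F) b
  counit_odd : ∀ a ∈ gr 1, Coalgebra.counit (R := F) a = 0
  comul_even : ∀ (i : ZMod 2), ∀ a ∈ gr i, Coalgebra.comul (R := F) a ∈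
    ⨆ j : ZMod 2, Submodule.map₂ (TensorProduct.mk F A A) (gr j) (gr (i - j))
  comul_one : GradedTensorProduct.of F gr gr (Coalgebra.comul (R := F) (1 : A)) = 1
  comul_mul : ∀ a b : A, GradedTensorProduct.of F gr gr (Coalgebra.comul (R := F) (a * b)) =
    GradedTensorProduct.of F gr gr (Coalgebra.comul (R := F) a) *
      GradedTensorProduct.of F gr gr (Coalgebra.comul (R := F) b)
  antipode : A →ₐ[F] A
  antipode_even : ∀ (i : ZMod 2), ∀ a ∈ gr i, antipode a ∈ gr i
  antipode_bijective : Function.Bijective antipode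
  antipode_left : ∀ a : A, LinearMap.mul' F A
    (TensorProduct.map antipode.toLinearMap LinearMap.id (Coalgebra.comul (R := F) a)) =
      algebraMap F A (Coalgebra.counit (R := F) a)
  antipode_right : ∀ a : A, LinearMap.mul' F A
    (TensorProduct.map LinearMap.id antipode.toLinearMap (Coalgebra.comul (R := F) a)) =
      algebraMap F A (Coalgebra.counit (R := F) a)
  comul_antipode : ∀ a : A,
    GradedTensorProduct.of F gr gr (Coalgebra.comul (R := F) (antipode a)) =
      GradedTensorProduct.comm gr gr (GradedTensorProduct.of F gr gr
        (TensorProduct.map antipode.toLinearMap antipode.toLinearMap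
          (Coalgebra.comul (R := F) a)))

attribute [instance] HopfSuperalgebra.gradedAlgebra

/-- A pair `(g, x)` defining the supergroup `D_{g,x}`, where `D` is the diagonalizable group with
character group `X`: a character `g`, and an element `x` of `Lie(D)`, that is, an additive function
`X → F`, such that `g² = 1` if `x ≠ 0`. -/
structure SuperPair (F X : Type*) [Field F] [CommGroup X] where
  g : X
  x : Additive X →+ F
  sq_eq_one : x ≠ 0 → g ^ 2 = 1

/-- The coordinate superalgebra `F[D_{g,x}] = FX ⊕ (FX)z`, with `z` odd and `z² = 0`. -/
def CoordAlg {F X : Type*} [Field F] [CommGroup X] (_P : SuperPair F X) : Type _ :=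
  DualNumber (MonoidAlgebra F X)

namespace CoordAlg

variable {F X : Type*} [Field F] [CommGroup X] (P : SuperPair F X)

instance : CommRing (CoordAlg P) := inferInstanceAs (CommRing (DualNumber (MonoidAlgebra F X)))

instance : Algebra F (CoordAlg P) := inferInstanceAs (Algebra F (DualNumber (MonoidAlgebra F X)))

/-- The element `h` of `F[D_{g,x}]`, for `h ∈ X`. -/
def el (h : X) : CoordAlg P := TrivSqZeroExt.inl (MonoidAlgebra.single h (1 : F))

/-- The element `hz` of `F[D_{g,x}]`, for `h ∈ X`. -/
def elz (h : X) : CoordAlg P := TrivSqZeroExt.inr (MonoidAlgebra.single h (1 : F))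

/-- The linear map on `F[D_{g,x}]` with prescribed values on the basis of all `h` and `hz`. -/
def liftLin {N : Type*} [AddCommGroup N] [Module F N] (u v : X → N) : CoordAlg P →ₗ[F] N :=
  (Finsupp.linearCombination F u ∘ₗ (MonoidAlgebra.coeffLinearEquiv F).toLinearMap).coprod
    (Finsupp.linearCombination F v ∘ₗ (MonoidAlgebra.coeffLinearEquiv F).toLinearMap)

section
variable {N : Type*} [AddCommGroup N] [Module F N] (u v : X → N)

@[simp] theorem liftLin_el (h : X) : liftLin P u v (el P h) = u h := by
  have : liftLin P u v (el P h) = Finsupp.linearCombination F u (Finsupp.single h 1) +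
    Finsupp.linearCombination F v 0 := rfl
  simpa using this

@[simp] theorem liftLin_elz (h : X) : liftLin P u v (elz P h) = v h := by
  have : liftLin P u v (elz P h) = Finsupp.linearCombination F u 0 +
    Finsupp.linearCombination F v (Finsupp.single h 1) := rfl
  simpa using this

theorem induction {p : CoordAlg P → Prop} (h1 : ∀ h, p (el P h)) (h2 : ∀ h, p (elz P h))
    (h3 : ∀ a b, p a → p b → p (a + b)) (h4 : ∀ (c : F) a, p a → p (c • a)) (a : CoordAlg P) :
    p a := by
  have h0 : p 0 := by simpa using h4 0 _ (h1 1)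
  have e1 : ∀ r : MonoidAlgebra F X, p (TrivSqZeroExt.inl r : DualNumber (MonoidAlgebra F X)) := by
    intro r
    induction r using MonoidAlgebra.induction_linear with
    | zero => exact h0
    | add f g hf hg =>
      exact Eq.mpr (congrArg p (TrivSqZeroExt.inl_add (MonoidAlgebra F X) f g)) (h3 _ _ hf hg)
    | single h c =>
      have e : (MonoidAlgebra.single h c : MonoidAlgebra F X) = c • MonoidAlgebra.single h 1 := by
        rw [MonoidAlgebra.smul_single, smul_eq_mul, mul_one]
      rw [e]
      exact Eq.mpr (congrArg p (TrivSqZeroExt.inl_smul (MonoidAlgebra F X) c _)) (h4 c _ (h1 h))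
  have e2 : ∀ r : MonoidAlgebra F X, p (TrivSqZeroExt.inr r : DualNumber (MonoidAlgebra F X)) := by
    intro r
    induction r using MonoidAlgebra.induction_linear with
    | zero => exact h0
    | add f g hf hg =>
      exact Eq.mpr (congrArg p (TrivSqZeroExt.inr_add (MonoidAlgebra F X) f g)) (h3 _ _ hf hg)
    | single h c =>
      have e : (MonoidAlgebra.single h c : MonoidAlgebra F X) = c • MonoidAlgebra.single h 1 := by
        rw [MonoidAlgebra.smul_single, smul_eq_mul, mul_one]
      rw [e]
      exact Eq.mpr (congrArg p (TrivSqZeroExt.inr_smul (MonoidAlgebra F X) c _)) (h4 c _ (h2 h))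
  exact Eq.mp (congrArg p (TrivSqZeroExt.inl_fst_add_inr_snd_eq
    (R := MonoidAlgebra F X) (M := MonoidAlgebra F X) a))
    (h3 _ _ (e1 (TrivSqZeroExt.fst a)) (e2 (TrivSqZeroExt.snd a)))

variable {P} in
theorem lin_ext {f g : CoordAlg P →ₗ[F] N} (h1 : ∀ h, f (el P h) = g (el P h))
    (h2 : ∀ h, f (elz P h) = g (elz P h)) : f = g := by
  ext a
  induction a using CoordAlg.induction with
  | h1 h => exact h1 h
  | h2 h => exact h2 h
  | h3 a b ha hb => simp [ha, hb]
  | h4 c a ha => simp [ha]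

end

theorem one_eq : (1 : CoordAlg P) = el P 1 := rfl

theorem single_mul (h k : X) : (MonoidAlgebra.single (h * k) 1 : MonoidAlgebra F X) =
    MonoidAlgebra.single h 1 * MonoidAlgebra.single k 1 := by
  rw [MonoidAlgebra.single_mul_single, mul_one]

@[simp] theorem el_mul_el (h k : X) : el P h * el P k = el P (h * k) := by
  unfold el
  rw [single_mul]
  exact (TrivSqZeroExt.inl_mul (MonoidAlgebra F X) _ _).symm

@[simp] theorem el_mul_elz (h k : X) : el P h * elz P k = elz P (h * k) := by
  unfold el elz
  rw [single_mul]
  exact TrivSqZeroExt.inl_mul_inr (R := MonoidAlgebra F X) _ _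

@[simp] theorem elz_mul_el (h k : X) : elz P h * el P k = elz P (h * k) := by
  rw [mul_comm, el_mul_elz, mul_comm]

@[simp] theorem elz_mul_elz (h k : X) : elz P h * elz P k = 0 := 
  TrivSqZeroExt.inr_mul_inr _ _ _

/-- The comultiplication: `Δ(h) = h ⊗ h + x(h) hz ⊗ hgz` and `Δ(hz) = h ⊗ hz + hz ⊗ hg`, which
is `Δ(h)Δ(z)` for `Δ(z) = 1 ⊗ z + z ⊗ g`. -/
def comulLin : CoordAlg P →ₗ[F] CoordAlg P ⊗[F] CoordAlg P :=
  liftLin P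
    (fun h => el P h ⊗ₜ el P h + P.x (Additive.ofMul h) • (elz P h ⊗ₜ elz P (h * P.g)))
    (fun h => el P h ⊗ₜ elz P h + elz P h ⊗ₜ el P (h * P.g))

/-- The counit: `ε(h) = 1` and `ε(hz) = 0`. -/
def counitLin : CoordAlg P →ₗ[F] F := liftLin P (fun _ => 1) (fun _ => 0)

variable [NeZero (2 : F)]

theorem g_cases : P.x = 0 ∨ (P.g * P.g = 1 ∧ P.x (Additive.ofMul P.g) = 0) := by
  by_cases hx : P.x = 0
  · exact Or.inl hx
  · have h := P.sq_eq_one hx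
    rw [pow_two] at h
    refine Or.inr ⟨h, ?_⟩
    have h2 : (2 : F) * P.x (Additive.ofMul P.g) = 0 := by
      rw [two_mul, ← map_add, ← ofMul_mul, h, ofMul_one, map_zero]
    exact (mul_eq_zero.mp h2).resolve_left (NeZero.ne 2)

instance : Coalgebra F (CoordAlg P) where
  comul := comulLin P
  counit := counitLin P
  coassoc := by
    rcases g_cases P with hx | ⟨hg, hx⟩
    · refine lin_ext (fun h => ?_) (fun h => ?_)
      · simp [comulLin, hx]
      · simp [comulLin, hx, TensorProduct.add_tmul, TensorProduct.tmul_add, add_assoc]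
    · refine lin_ext (fun h => ?_) (fun h => ?_)
      · simp [comulLin, TensorProduct.add_tmul, TensorProduct.tmul_add, 
          ← TensorProduct.smul_tmul', mul_assoc, hg]
        abel
      · simp [comulLin, TensorProduct.add_tmul, TensorProduct.tmul_add, 
          ← TensorProduct.smul_tmul', mul_assoc, hg, hx]
        abel
  rTensor_counit_comp_comul := by
    refine lin_ext (fun h => ?_) (fun h => ?_) <;> simp [comulLin, counitLin]
  lTensor_counit_comp_comul := by
    refine lin_ext (fun h => ?_) (fun h => ?_) <;> simp [comulLin, counitLin]

@[simp] theorem comul_el (h : X) : Coalgebra.comul (R := F) (el P h) =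
    el P h ⊗ₜ el P h + P.x (Additive.ofMul h) • (elz P h ⊗ₜ elz P (h * P.g)) :=
  liftLin_el P _ _ h

@[simp] theorem comul_elz (h : X) : Coalgebra.comul (R := F) (elz P h) =
    el P h ⊗ₜ[F] elz P h + elz P h ⊗ₜ el P (h * P.g) :=
  liftLin_elz P _ _ h

@[simp] theorem counit_el (h : X) : Coalgebra.counit (R := F) (el P h) = 1 :=
  liftLin_el P _ _ h

@[simp] theorem counit_elz (h : X) : Coalgebra.counit (R := F) (elz P h) = 0 :=
  liftLin_elz P _ _ h

end CoordAlg

/-- The multiplication of the graded tensor product, on elements given with their degrees. -/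
theorem gradedTensor_mul {F A B : Type*} [Field F] [Ring A] [Ring B] [Algebra F A] [Algebra F B]
    (𝒜 : ZMod 2 → Submodule F A) (ℬ : ZMod 2 → Submodule F B) [GradedAlgebra 𝒜] [GradedAlgebra ℬ]
    {i j : ZMod 2} (a₁ : A) {b₁ : B} (hb : b₁ ∈ ℬ j) {a₂ : A} (ha : a₂ ∈ 𝒜 i) (b₂ : B) :
    GradedTensorProduct.of F 𝒜 ℬ (a₁ ⊗ₜ b₁) * GradedTensorProduct.of F 𝒜 ℬ (a₂ ⊗ₜ b₂) =
      ((-1 : ℤˣ) ^ (j * i)) • GradedTensorProduct.of F 𝒜 ℬ ((a₁ * a₂) ⊗ₜ (b₁ * b₂)) :=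
  GradedTensorProduct.tmul_coe_mul_coe_tmul 𝒜 ℬ a₁ ⟨b₁, hb⟩ ⟨a₂, ha⟩ b₂

namespace CoordAlg

variable {F X : Type*} [Field F] [CommGroup X] (P : SuperPair F X)

/-- The basis of the even (`i = 0`) and of the odd (`i = 1`) part. -/
def bas (i : ZMod 2) (h : X) : CoordAlg P := if i = 0 then el P h else elz P h

/-- The even part is `FX` and the odd part is `(FX)z`. -/
def gr (i : ZMod 2) : Submodule F (CoordAlg P) := Submodule.span F (Set.range (bas P i))

theorem el_mem (h : X) : el P h ∈ gr P 0 := Submodule.subset_span ⟨h, rfl⟩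

theorem elz_mem (h : X) : elz P h ∈ gr P 1 := Submodule.subset_span ⟨h, rfl⟩

theorem zmod2_cases (i : ZMod 2) : i = 0 ∨ i = 1 := by
  revert i; decide

theorem gr_induction {i : ZMod 2} {p : ZMod 2 → CoordAlg P → Prop}
    (h1 : ∀ h, p 0 (el P h)) (h2 : ∀ h, p 1 (elz P h)) (h0 : ∀ i, p i 0)
    (h3 : ∀ i a b, p i a → p i b → p i (a + b)) (h4 : ∀ i (c : F) a, p i a → p i (c • a))
    {a : CoordAlg P} (ha : a ∈ gr P i) : p i a := by
  refine Submodule.span_induction ?_ (h0 i) (fun a b _ _ => h3 i a b) (fun c a _ => h4 i c a) ha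
  rintro _ ⟨h, rfl⟩
  rcases zmod2_cases i with rfl | rfl
  · exact h1 h
  · exact h2 h

instance : SetLike.GradedMonoid (gr P) where
  one_mem := el_mem P 1
  mul_mem i j a b ha hb := by
    refine gr_induction P (p := fun i a => a * b ∈ gr P (i + j)) ?_ ?_ ?_ ?_ ?_ ha
    · intro h
      refine gr_induction P (p := fun j b => el P h * b ∈ gr P (0 + j)) ?_ ?_ ?_ ?_ ?_ hb
      · intro k; rw [el_mul_el]; exact el_mem P _
      · intro k; rw [el_mul_elz]; exact elz_mem P _
      · intro i; simp
      · intro i a b h1 h2; rw [mul_add]; exact add_mem h1 h2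
      · intro i c a h1; rw [mul_smul_comm]; exact Submodule.smul_mem _ _ h1
    · intro h
      refine gr_induction P (p := fun j b => elz P h * b ∈ gr P (1 + j)) ?_ ?_ ?_ ?_ ?_ hb
      · intro k; rw [elz_mul_el]; exact elz_mem P _
      · intro k; rw [elz_mul_elz]; exact zero_mem _
      · intro i; simp
      · intro i a b h1 h2; rw [mul_add]; exact add_mem h1 h2
      · intro i c a h1; rw [mul_smul_comm]; exact Submodule.smul_mem _ _ h1
    · intro i; simp
    · intro i a b h1 h2; rw [add_mul]; exact add_mem h1 h2
    · intro i c a h1; rw [smul_mul_assoc]; exact Submodule.smul_mem _ _ h1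

/-- The decomposition of an element into its even and odd parts. -/
def decomp : CoordAlg P →ₗ[F] ⨁ i, gr P i :=
  liftLin P (fun h => DirectSum.lof F (ZMod 2) (fun i => gr P i) 0 ⟨el P h, el_mem P h⟩)
    (fun h => DirectSum.lof F (ZMod 2) (fun i => gr P i) 1 ⟨elz P h, elz_mem P h⟩)

theorem decomp_mem {i : ZMod 2} {a : CoordAlg P} (ha : a ∈ gr P i) :
    decomp P a = DirectSum.lof F (ZMod 2) (fun i => gr P i) i ⟨a, ha⟩ := by
  have := gr_induction P (p := fun i a => ∃ ha : a ∈ gr P i,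
    decomp P a = DirectSum.lof F (ZMod 2) (fun i => gr P i) i ⟨a, ha⟩) ?_ ?_ ?_ ?_ ?_ ha
  · exact this.2
  · exact fun h => ⟨el_mem P h, liftLin_el P _ _ h⟩
  · exact fun h => ⟨elz_mem P h, liftLin_elz P _ _ h⟩
  · exact fun i => ⟨zero_mem _, by rw [map_zero]; exact (map_zero _).symm⟩
  · rintro i a b ⟨h1, e1⟩ ⟨h2, e2⟩
    refine ⟨add_mem h1 h2, ?_⟩
    rw [map_add, e1, e2, ← map_add]; rfl
  · rintro i c a ⟨h1, e1⟩
    refine ⟨Submodule.smul_mem _ c h1, ?_⟩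
    rw [map_smul, e1, ← map_smul]; rfl

instance : DirectSum.Decomposition (gr P) :=
  DirectSum.Decomposition.ofLinearMap (gr P) (decomp P)
    (by
      refine lin_ext (fun h => ?_) (fun h => ?_)
      · simp [decomp]
      · simp [decomp])
    (by
      ext i ⟨a, ha⟩ : 2
      simpa using decomp_mem P ha)

instance : GradedAlgebra (gr P) where

/-- The antipode: `s(h) = h⁻¹` and `s(hz) = - (hg)⁻¹ z`, that is, `s(z) = - g⁻¹ z`. -/
def antipodeLin : CoordAlg P →ₗ[F] CoordAlg P :=
  liftLin P (fun h => el P h⁻¹) (fun h => - elz P (h * P.g)⁻¹)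

@[simp] theorem antipodeLin_el (h : X) : antipodeLin P (el P h) = el P h⁻¹ :=
  liftLin_el P _ _ h

@[simp] theorem antipodeLin_elz (h : X) : antipodeLin P (elz P h) = - elz P (h * P.g)⁻¹ :=
  liftLin_elz P _ _ h

/-- A bilinear identity on `F[D_{g,x}]` can be checked on the basis. -/
theorem bilin_ext {N : Type*} [AddCommGroup N] [Module F N]
    {f g : CoordAlg P →ₗ[F] CoordAlg P →ₗ[F] N}
    (h1 : ∀ h k, f (el P h) (el P k) = g (el P h) (el P k))
    (h2 : ∀ h k, f (el P h) (elz P k) = g (el P h) (elz P k))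
    (h3 : ∀ h k, f (elz P h) (el P k) = g (elz P h) (el P k))
    (h4 : ∀ h k, f (elz P h) (elz P k) = g (elz P h) (elz P k)) (a b : CoordAlg P) :
    f a b = g a b := by
  have : f = g := lin_ext (fun h => lin_ext (h1 h) (h2 h)) (fun h => lin_ext (h3 h) (h4 h))
  rw [this]

theorem antipodeLin_mul (a b : CoordAlg P) :
    antipodeLin P (a * b) = antipodeLin P a * antipodeLin P b :=
  bilin_ext P (f := (LinearMap.mul F (CoordAlg P)).compr₂ (antipodeLin P))
    (g := (LinearMap.mul F (CoordAlg P)).compl₁₂ (antipodeLin P) (antipodeLin P))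
    (fun h k => by simp [mul_comm]) (fun h k => by simp [mul_comm, mul_left_comm])
    (fun h k => by simp [mul_comm, mul_left_comm]) (fun h k => by simp) a b

/-- The antipode as an endomorphism of algebras. -/
def antipodeHom : CoordAlg P →ₐ[F] CoordAlg P :=
  AlgHom.ofLinearMap (antipodeLin P) (by rw [one_eq]; simp) (antipodeLin_mul P)

theorem antipodeLin_antipodeLin (a : CoordAlg P) : antipodeLin P (antipodeLin P a) = a := by
  induction a using CoordAlg.induction with
  | h1 h => simp
  | h2 h => simp
  | h3 a b ha hb => simp [ha, hb]
  | h4 c a ha => simp [ha]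

variable [NeZero (2 : F)]

theorem comul_mul (a b : CoordAlg P) :
    GradedTensorProduct.of F (gr P) (gr P) (Coalgebra.comul (R := F) (a * b)) =
      GradedTensorProduct.of F (gr P) (gr P) (Coalgebra.comul (R := F) a) *
        GradedTensorProduct.of F (gr P) (gr P) (Coalgebra.comul (R := F) b) := by
  refine bilin_ext P
    (f := (LinearMap.mul F (CoordAlg P)).compr₂
      ((GradedTensorProduct.of F (gr P) (gr P)).toLinearMap ∘ₗ Coalgebra.comul))
    (g := (LinearMap.mul F (GradedTensorProduct F (gr P) (gr P))).compl₁₂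
      ((GradedTensorProduct.of F (gr P) (gr P)).toLinearMap ∘ₗ Coalgebra.comul)
      ((GradedTensorProduct.of F (gr P) (gr P)).toLinearMap ∘ₗ Coalgebra.comul)) ?_ ?_ ?_ ?_ a b
  all_goals
    intro h k
    simp only [LinearMap.compr₂_apply, LinearMap.compl₁₂_apply, LinearMap.mul_apply',
      LinearMap.comp_apply, LinearEquiv.coe_coe, comul_el, comul_elz, map_add, map_smul, add_mul,
      mul_add, smul_mul_assoc, mul_smul_comm, el_mul_el, el_mul_elz, elz_mul_el, elz_mul_elz,
      LinearMap.add_apply, LinearMap.smul_apply,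
      gradedTensor_mul (gr P) (gr P) _ (el_mem P _) (el_mem P _),
      gradedTensor_mul (gr P) (gr P) _ (el_mem P _) (elz_mem P _),
      gradedTensor_mul (gr P) (gr P) _ (elz_mem P _) (el_mem P _),
      gradedTensor_mul (gr P) (gr P) _ (elz_mem P _) (elz_mem P _)]
    simp only [zero_mul, mul_zero, one_mul, uzpow_zero, one_smul, uzpow_one, TensorProduct.tmul_zero,
      smul_zero, add_zero, zero_add, map_zero, ofMul_mul, map_add, add_smul, TensorProduct.zero_tmul,
      mul_right_comm _ P.g, ← mul_assoc, Units.neg_smul, neg_add_cancel, add_neg_cancel]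
    try abel

/-- The Hopf superalgebra `F[D_{g,x}]`. -/
def hopf : HopfSuperalgebra F (CoordAlg P) where
  gr := gr P
  gradedAlgebra := inferInstance
  supercomm i j a b ha hb := by
    refine gr_induction P (p := fun i a => a * b = ((-1 : ℤˣ) ^ (i * j)) • (b * a))
      ?_ ?_ ?_ ?_ ?_ ha
    · intro h; simp [mul_comm]
    · intro h
      refine gr_induction P (p := fun j b => elz P h * b = ((-1 : ℤˣ) ^ (1 * j)) • (b * elz P h))
        ?_ ?_ ?_ ?_ ?_ hb
      · intro k; simp [mul_comm]
      · intro k; simp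
      · intro i; simp
      · intro i a b h1 h2; rw [mul_add, add_mul, h1, h2, smul_add]
      · intro i c a h1; rw [mul_smul_comm, smul_mul_assoc, h1, smul_comm]
    · intro i; simp
    · intro i a b h1 h2; rw [mul_add, add_mul, h1, h2, smul_add]
    · intro i c a h1; rw [mul_smul_comm, smul_mul_assoc, h1, smul_comm]
  counit_one := counit_el P 1
  counit_mul a b := bilin_ext P
    (f := (LinearMap.mul F (CoordAlg P)).compr₂ Coalgebra.counit)
    (g := (LinearMap.mul F F).compl₁₂ Coalgebra.counit Coalgebra.counit)
    (fun h k => by simp) (fun h k => by simp) (fun h k => by simp) (fun h k => by simp) a b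
  counit_odd a ha := by
    refine gr_induction P (p := fun i a => i = 1 → Coalgebra.counit (R := F) a = 0)
      ?_ ?_ ?_ ?_ ?_ ha rfl
    · intro h h0; exact absurd h0 (by decide)
    · intro h _; simp
    · intro i _; simp
    · intro i a b h1 h2 hi; rw [map_add, h1 hi, h2 hi, add_zero]
    · intro i c a h1 hi; rw [map_smul, h1 hi, smul_zero]
  comul_even i a ha := by
    refine gr_induction P (p := fun i a => Coalgebra.comul (R := F) a ∈ ⨆ j : ZMod 2,
      Submodule.map₂ (TensorProduct.mk F (CoordAlg P) (CoordAlg P)) (gr P j) (gr P (i - j)))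
      ?_ ?_ ?_ ?_ ?_ ha
    · intro h
      rw [comul_el]
      refine add_mem ?_ (Submodule.smul_mem _ _ ?_)
      · exact Submodule.mem_iSup_of_mem 0 (Submodule.apply_mem_map₂ _ (el_mem P h) (el_mem P h))
      · exact Submodule.mem_iSup_of_mem 1 (Submodule.apply_mem_map₂ _ (elz_mem P h) (elz_mem P _))
    · intro h
      rw [comul_elz]
      refine add_mem ?_ ?_
      · exact Submodule.mem_iSup_of_mem 0 (Submodule.apply_mem_map₂ _ (el_mem P h) (elz_mem P h))
      · exact Submodule.mem_iSup_of_mem 1 (Submodule.apply_mem_map₂ _ (elz_mem P h) (el_mem P _))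
    · intro i; simp
    · intro i a b h1 h2; rw [map_add]; exact add_mem h1 h2
    · intro i c a h1; rw [map_smul]; exact Submodule.smul_mem _ _ h1
  comul_one := by
    rw [one_eq, comul_el]
    simp only [ofMul_one, map_zero, zero_smul, add_zero]
    rfl
  comul_mul := comul_mul P
  antipode := antipodeHom P
  antipode_even i a ha := by
    refine gr_induction P (p := fun i a => antipodeLin P a ∈ gr P i) ?_ ?_ ?_ ?_ ?_ ha
    · intro h; rw [antipodeLin_el]; exact el_mem P _
    · intro h; rw [antipodeLin_elz]; exact neg_mem (elz_mem P _)
    · intro i; simp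
    · intro i a b h1 h2; rw [map_add]; exact add_mem h1 h2
    · intro i c a h1; rw [map_smul]; exact Submodule.smul_mem _ _ h1
  antipode_bijective := Function.Involutive.bijective (antipodeLin_antipodeLin P)
  antipode_left a := by
    have e : (antipodeHom P).toLinearMap = antipodeLin P := rfl
    rw [e]
    induction a using CoordAlg.induction with
    | h1 h => simp [one_eq]
    | h2 h => simp
    | h3 a b ha hb => simp only [map_add, ha, hb]
    | h4 c a ha => rw [map_smul, map_smul, map_smul, ha, map_smul, smul_eq_mul, map_mul,
        Algebra.smul_def]
  antipode_right a := by
    have e : (antipodeHom P).toLinearMap = antipodeLin P := rfl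
    rw [e]
    induction a using CoordAlg.induction with
    | h1 h => simp [one_eq]
    | h2 h => simp [mul_comm]
    | h3 a b ha hb => simp only [map_add, ha, hb]
    | h4 c a ha => rw [map_smul, map_smul, map_smul, ha, map_smul, smul_eq_mul, map_mul,
        Algebra.smul_def]
  comul_antipode a := by
    have e : (antipodeHom P).toLinearMap = antipodeLin P := rfl
    have e' : ∀ a, antipodeHom P a = antipodeLin P a := fun _ => rfl
    have c00 : ∀ h k, GradedTensorProduct.comm (gr P) (gr P) (GradedTensorProduct.of F (gr P) (gr P)
        (el P h ⊗ₜ el P k)) = GradedTensorProduct.of F (gr P) (gr P) (el P k ⊗ₜ el P h) :=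
      fun h k => by
        simpa using GradedTensorProduct.comm_coe_tmul_coe (gr P) (gr P)
          ⟨_, el_mem P h⟩ ⟨_, el_mem P k⟩
    have c01 : ∀ h k, GradedTensorProduct.comm (gr P) (gr P) (GradedTensorProduct.of F (gr P) (gr P)
        (el P h ⊗ₜ elz P k)) = GradedTensorProduct.of F (gr P) (gr P) (elz P k ⊗ₜ el P h) :=
      fun h k => by
        simpa using GradedTensorProduct.comm_coe_tmul_coe (gr P) (gr P)
          ⟨_, el_mem P h⟩ ⟨_, elz_mem P k⟩
    have c10 : ∀ h k, GradedTensorProduct.comm (gr P) (gr P) (GradedTensorProduct.of F (gr P) (gr P)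
        (elz P h ⊗ₜ el P k)) = GradedTensorProduct.of F (gr P) (gr P) (el P k ⊗ₜ elz P h) :=
      fun h k => by
        simpa using GradedTensorProduct.comm_coe_tmul_coe (gr P) (gr P)
          ⟨_, elz_mem P h⟩ ⟨_, el_mem P k⟩
    have c11 : ∀ h k, GradedTensorProduct.comm (gr P) (gr P) (GradedTensorProduct.of F (gr P) (gr P)
        (elz P h ⊗ₜ elz P k)) = - GradedTensorProduct.of F (gr P) (gr P) (elz P k ⊗ₜ elz P h) :=
      fun h k => by
        simpa using GradedTensorProduct.comm_coe_tmul_coe (gr P) (gr P)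
          ⟨_, elz_mem P h⟩ ⟨_, elz_mem P k⟩
    rw [e, e']
    induction a using CoordAlg.induction with
    | h1 h =>
      rcases g_cases P with hx | ⟨hg, hx⟩
      · simp [hx, c00]
      · simp [c00, c11, TensorProduct.neg_tmul, TensorProduct.tmul_neg, mul_assoc, hg, inv_eq_of_mul_eq_one_left hg, mul_comm P.g]
    | h2 h => simp [c01, c10, TensorProduct.neg_tmul, TensorProduct.tmul_neg]
    | h3 a b ha hb => simp only [map_add, ha, hb]
    | h4 c a ha => simp only [map_smul, ha]

end CoordAlg

namespace PurelyEven

variable (F B : Type*) [Field F] [CommRing B] [HopfAlgebra F B]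

/-- The trivial grading: everything is even. -/
def gr (i : ZMod 2) : Submodule F B := if i = 0 then ⊤ else ⊥

theorem mem_zero (b : B) : b ∈ gr F B 0 := Submodule.mem_top

theorem gr_cases {i : ZMod 2} {b : B} (hb : b ∈ gr F B i) : i = 0 ∨ b = 0 := by
  unfold gr at hb
  split_ifs at hb with h
  · exact Or.inl h
  · exact Or.inr hb

instance : SetLike.GradedMonoid (gr F B) where
  one_mem := mem_zero F B 1
  mul_mem i j a b ha hb := by
    rcases gr_cases F B ha with rfl | rfl
    · rcases gr_cases F B hb with rfl | rfl
      · exact mem_zero F B _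
      · simp
    · simp

instance : DirectSum.Decomposition (gr F B) :=
  DirectSum.Decomposition.ofLinearMap (gr F B)
    (DirectSum.lof F (ZMod 2) (fun i => gr F B i) 0 ∘ₗ
      LinearMap.codRestrict (gr F B 0) LinearMap.id (mem_zero F B))
    (by ext b; simp)
    (by
      ext i ⟨b, hb⟩ : 2
      rcases gr_cases F B hb with rfl | rfl
      · simp; rfl
      · simp only [LinearMap.comp_apply, DirectSum.coeLinearMap_lof]
        exact map_zero (DirectSum.lof F (ZMod 2) (fun i => gr F B i) 0) |>.trans
          (map_zero (DirectSum.lof F (ZMod 2) (fun i => gr F B i) i)).symm)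

instance : GradedAlgebra (gr F B) where

theorem of_mul (u v : B ⊗[F] B) : GradedTensorProduct.of F (gr F B) (gr F B) (u * v) =
    GradedTensorProduct.of F (gr F B) (gr F B) u * GradedTensorProduct.of F (gr F B) (gr F B) v := by
  induction u using TensorProduct.induction_on with
  | zero => simp
  | add u u' hu hu' => rw [add_mul, map_add, hu, hu', map_add, add_mul]
  | tmul a b =>
    induction v using TensorProduct.induction_on with
    | zero => simp
    | add v v' hv hv' => rw [mul_add, map_add, hv, hv', map_add, mul_add]
    | tmul c d =>
      rw [gradedTensor_mul (gr F B) (gr F B) _ (mem_zero F B b) (mem_zero F B c)]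
      simp

theorem of_comm (u : B ⊗[F] B) :
    GradedTensorProduct.comm (gr F B) (gr F B) (GradedTensorProduct.of F (gr F B) (gr F B) u) =
      GradedTensorProduct.of F (gr F B) (gr F B) (TensorProduct.comm F B B u) := by
  induction u using TensorProduct.induction_on with
  | zero => simp
  | add u u' hu hu' => simp only [map_add, hu, hu']
  | tmul a b =>
    simpa using GradedTensorProduct.comm_coe_tmul_coe (gr F B) (gr F B)
      ⟨a, mem_zero F B a⟩ ⟨b, mem_zero F B b⟩

/-- A commutative Hopf algebra, viewed as a purely even Hopf superalgebra. (The two properties of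
the antipode hold for every commutative Hopf algebra.) -/
def hopf (h1 : ∀ b : B, HopfAlgebra.antipode F (HopfAlgebra.antipode F b) = b)
    (h2 : ∀ b : B, Coalgebra.comul (R := F) (HopfAlgebra.antipode F b) = TensorProduct.comm F B B
      (TensorProduct.map (HopfAlgebra.antipode F) (HopfAlgebra.antipode F)
        (Coalgebra.comul (R := F) b))) : HopfSuperalgebra F B where
  gr := gr F B
  gradedAlgebra := inferInstance
  supercomm i j a b ha hb := by
    rcases gr_cases F B ha with rfl | rfl
    · simp [mul_comm]
    · simp
  counit_one := Bialgebra.counit_one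
  counit_mul := Bialgebra.counit_mul
  counit_odd a ha := by
    rcases gr_cases F B ha with h | rfl
    · exact absurd h (by decide)
    · simp
  comul_even i a ha := by
    rcases gr_cases F B ha with rfl | rfl
    · refine Submodule.mem_iSup_of_mem 0 ?_
      generalize Coalgebra.comul (R := F) a = u
      induction u using TensorProduct.induction_on with
      | zero => exact zero_mem _
      | add u v hu hv => exact add_mem hu hv
      | tmul a b => exact Submodule.apply_mem_map₂ _ (mem_zero F B a) (mem_zero F B b)
    · simp
  comul_one := by rw [Bialgebra.comul_one]; rfl
  comul_mul a b := by rw [Bialgebra.comul_mul, of_mul]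
  antipode := HopfAlgebra.antipodeAlgHom F B
  antipode_even i a ha := by
    rcases gr_cases F B ha with rfl | rfl
    · exact mem_zero F B _
    · simp
  antipode_bijective := Function.Involutive.bijective (f := HopfAlgebra.antipode F) h1
  antipode_left a := HopfAlgebra.mul_antipode_rTensor_comul_apply a
  antipode_right a := HopfAlgebra.mul_antipode_lTensor_comul_apply a
  comul_antipode a := by
    rw [of_comm]
    exact congrArg _ (h2 a)

end PurelyEven

namespace SuperPair

variable {F X : Type*} [Field F] [CommGroup X] (P : SuperPair F X)

/-- The ideal `FX(g - 1)` of `FX = F[D]`. -/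
def kerIdeal : Ideal (MonoidAlgebra F X) :=
  Ideal.span {MonoidAlgebra.single P.g (1 : F) - 1}

instance : Ideal.IsHopfIdeal F P.kerIdeal where
  counit_eq_zero x hx := by
    have h : P.kerIdeal ≤ RingHom.ker (Bialgebra.counitAlgHom F (MonoidAlgebra F X)) := by
      rw [kerIdeal, Ideal.span_le, Set.singleton_subset_iff]
      change Bialgebra.counitAlgHom F (MonoidAlgebra F X) _ = 0
      rw [map_sub, map_one]
      simp
    exact h hx
  map_mkQ_comul_eq_zero x hx := by
    have h : P.kerIdeal ≤ RingHom.ker ((Algebra.TensorProduct.map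
        (Ideal.Quotient.mkₐ F P.kerIdeal) (Ideal.Quotient.mkₐ F P.kerIdeal)).comp
        (Bialgebra.comulAlgHom F (MonoidAlgebra F X))) := by
      have e : Ideal.Quotient.mkₐ F P.kerIdeal (MonoidAlgebra.single P.g (1 : F)) = 1 := by
        rw [← sub_eq_zero, ← map_one (Ideal.Quotient.mkₐ F P.kerIdeal), ← map_sub]
        exact Ideal.Quotient.eq_zero_iff_mem.mpr (Ideal.subset_span rfl)
      conv_lhs => rw [kerIdeal]
      rw [Ideal.span_le, Set.singleton_subset_iff]
      change AlgHom.comp _ _ _ = 0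
      rw [map_sub, map_one, AlgHom.comp_apply, Bialgebra.comulAlgHom_apply,
        MonoidAlgebra.comul_single, CommSemiring.comul_apply, TensorProduct.map_tmul,
        MonoidAlgebra.lsingle_apply, Algebra.TensorProduct.map_tmul, e]
      exact sub_self _
    exact h hx
  antipode_mem x hx := by
    have h : P.kerIdeal ≤ Ideal.comap (HopfAlgebra.antipodeAlgHom F (MonoidAlgebra F X))
        P.kerIdeal := by
      conv_lhs => rw [kerIdeal]
      rw [Ideal.span_le, Set.singleton_subset_iff]
      change HopfAlgebra.antipodeAlgHom F (MonoidAlgebra F X) _ ∈ P.kerIdeal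
      have e : HopfAlgebra.antipodeAlgHom F (MonoidAlgebra F X)
          (MonoidAlgebra.single P.g (1 : F) - 1) =
          (- MonoidAlgebra.single P.g⁻¹ (1 : F)) * (MonoidAlgebra.single P.g (1 : F) - 1) := by
        rw [map_sub, map_one, mul_sub, mul_one, neg_mul, MonoidAlgebra.single_mul_single,
          inv_mul_cancel, mul_one, ← MonoidAlgebra.one_def]
        change HopfAlgebra.antipode F (MonoidAlgebra.single P.g (1 : F)) - 1 = _
        rw [MonoidAlgebra.antipode_single]
        simp
        ring
      rw [e]
      exact Ideal.mul_mem_left _ _ (Ideal.subset_span rfl)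
    exact h hx

/-- The coordinate algebra `F[D'] = FX / FX(g - 1)` of the kernel `D' ⊆ D` of the character `g`. -/
abbrev KerCoord : Type _ := MonoidAlgebra F X ⧸ P.kerIdeal

theorem kerCoord_induction {p : P.KerCoord → Prop}
    (h1 : ∀ h : X, p (Ideal.Quotient.mk P.kerIdeal (MonoidAlgebra.single h 1)))
    (h3 : ∀ a b, p a → p b → p (a + b)) (h4 : ∀ (c : F) a, p a → p (c • a)) (a : P.KerCoord) :
    p a := by
  obtain ⟨r, rfl⟩ := Ideal.Quotient.mk_surjective a
  induction r using MonoidAlgebra.induction_linear with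
  | zero => simpa using h4 0 _ (h1 1)
  | add f g hf hg => rw [map_add]; exact h3 _ _ hf hg
  | single h c =>
    have e : (MonoidAlgebra.single h c : MonoidAlgebra F X) = c • MonoidAlgebra.single h 1 := by
      rw [MonoidAlgebra.smul_single, smul_eq_mul, mul_one]
    rw [e]
    exact h4 c _ (h1 h)

/-- The Hopf superalgebra `F[D']` of the purely even supergroup `D'`. -/
def kerHopf : HopfSuperalgebra F P.KerCoord :=
  PurelyEven.hopf F P.KerCoord
    (fun b => by
      induction b using kerCoord_induction with
      | h1 h => simp [HopfAlgebra.Quotient.antipode_mk]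
      | h3 a b ha hb => simp [ha, hb]
      | h4 c a ha => simp [ha])
    (fun b => by
      induction b using kerCoord_induction with
      | h1 h => simp [HopfAlgebra.Quotient.antipode_mk]
      | h3 a b ha hb => simp only [map_add, ha, hb]
      | h4 c a ha => simp only [map_smul, ha])

/-- The restriction homomorphism `F[D_{g,x}] → F[D']`, `h ↦ h`, `z ↦ 0`, as an algebra
homomorphism. -/
def restrictAlgHom : CoordAlg P →ₐ[F] P.KerCoord :=
  ((Ideal.Quotient.mkₐ F P.kerIdeal).comp
    (TrivSqZeroExt.fstHom F (MonoidAlgebra F X) (MonoidAlgebra F X)) :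
      DualNumber (MonoidAlgebra F X) →ₐ[F] P.KerCoord)

@[simp] theorem restrictAlgHom_el (h : X) : P.restrictAlgHom (CoordAlg.el P h) =
    Ideal.Quotient.mk P.kerIdeal (MonoidAlgebra.single h 1) := rfl

@[simp] theorem restrictAlgHom_elz (h : X) : P.restrictAlgHom (CoordAlg.elz P h) = 0 :=
  map_zero (Ideal.Quotient.mk P.kerIdeal)

variable [NeZero (2 : F)]

/-- The restriction homomorphism `F[D_{g,x}] → F[D']`, `h ↦ h`, `z ↦ 0`, which defines `D'` as a
(purely even) subsupergroup of `D_{g,x}`. -/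
def restrictHom : CoordAlg P →ₐc[F] P.KerCoord where
  toFun := P.restrictAlgHom
  map_add' := map_add _
  map_smul' := map_smul P.restrictAlgHom
  map_one' := map_one _
  map_mul' := map_mul _
  counit_comp := CoordAlg.lin_ext
    (fun h => by
      change Coalgebra.counit (R := F) (P.restrictAlgHom (CoordAlg.el P h)) = _
      simp)
    (fun h => by
      change Coalgebra.counit (R := F) (P.restrictAlgHom (CoordAlg.elz P h)) = _
      simp)
  map_comp_comul := CoordAlg.lin_ext
    (fun h => by
      change TensorProduct.map P.restrictAlgHom.toLinearMap P.restrictAlgHom.toLinearMap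
        (Coalgebra.comul (R := F) (CoordAlg.el P h)) =
          Coalgebra.comul (R := F) (P.restrictAlgHom (CoordAlg.el P h))
      simp)
    (fun h => by
      change TensorProduct.map P.restrictAlgHom.toLinearMap P.restrictAlgHom.toLinearMap
        (Coalgebra.comul (R := F) (CoordAlg.elz P h)) =
          Coalgebra.comul (R := F) (P.restrictAlgHom (CoordAlg.elz P h))
      simp)

theorem restrictHom_even (i : ZMod 2) (a : CoordAlg P) (ha : a ∈ (CoordAlg.hopf P).gr i) :
    P.restrictHom a ∈ P.kerHopf.gr i := by
  refine CoordAlg.gr_induction P (p := fun i a => P.restrictAlgHom a ∈ P.kerHopf.gr i)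
    ?_ ?_ ?_ ?_ ?_ ha
  · exact fun h => PurelyEven.mem_zero F _ _
  · intro h; rw [restrictAlgHom_elz]; exact zero_mem _
  · intro i; simp
  · intro i a b h1 h2; rw [map_add]; exact add_mem h1 h2
  · intro i c a h1; rw [map_smul]; exact Submodule.smul_mem _ _ h1

end SuperPair

section SuperPoly

variable (F : Type*) [Field F] {ι : Type*} (p : ι → ZMod 2)

/-- The relations of supercommutativity between the generators of a polynomial superalgebra. -/
inductive SuperPolyRel : FreeAlgebra F ι → FreeAlgebra F ι → Prop
  | comm (i j : ι) : SuperPolyRel (FreeAlgebra.ι F i * FreeAlgebra.ι F j)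
      (((-1 : ℤˣ) ^ (p i * p j)) • (FreeAlgebra.ι F j * FreeAlgebra.ι F i))

/-- The polynomial superalgebra over `F`, freely generated as a supercommutative superalgebra by
generators `x_i` of parity `p i`. (The characteristic of `F` is not `2`, hence `x_i² = 0` for odd
generators.) -/
def SuperPoly : Type _ := RingQuot (SuperPolyRel F p)

namespace SuperPoly

instance : Ring (SuperPoly F p) := inferInstanceAs (Ring (RingQuot (SuperPolyRel F p)))

instance : Algebra F (SuperPoly F p) := inferInstanceAs (Algebra F (RingQuot (SuperPolyRel F p)))

/-- The generator `x_i`. -/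
def X (i : ι) : SuperPoly F p := RingQuot.mkAlgHom F (SuperPolyRel F p) (FreeAlgebra.ι F i)

theorem X_mul_X (i j : ι) : X F p i * X F p j = ((-1 : ℤˣ) ^ (p i * p j)) • (X F p j * X F p i) := by
  have h := RingQuot.mkAlgHom_rel F (SuperPolyRel.comm (F := F) (p := p) i j)
  rw [map_mul, Units.smul_def, map_zsmul, map_mul] at h
  rw [Units.smul_def]
  exact h

variable {F p} in
/-- The universal property of the polynomial superalgebra. -/
def lift {B : Type*} [Ring B] [Algebra F B] (y : ι → B)
    (hy : ∀ i j, y i * y j = ((-1 : ℤˣ) ^ (p i * p j)) • (y j * y i)) : SuperPoly F p →ₐ[F] B :=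
  RingQuot.liftAlgHom F ⟨FreeAlgebra.lift F y, by
    rintro _ _ ⟨i, j⟩
    rw [map_mul, Units.smul_def, map_zsmul, map_mul]
    simpa [Units.smul_def] using hy i j⟩

variable {F p} in
@[simp] theorem lift_X {B : Type*} [Ring B] [Algebra F B] (y : ι → B)
    (hy : ∀ i j, y i * y j = ((-1 : ℤˣ) ^ (p i * p j)) • (y j * y i)) (i : ι) :
    lift y hy (X F p i) = y i := by
  have : lift y hy (X F p i) = FreeAlgebra.lift F y (FreeAlgebra.ι F i) :=
    RingQuot.liftAlgHom_mkAlgHom_apply F _ _ _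
  rw [this, FreeAlgebra.lift_ι_apply]

variable {F p} in
theorem algHom_ext {B : Type*} [Ring B] [Algebra F B] {f g : SuperPoly F p →ₐ[F] B}
    (h : ∀ i, f (X F p i) = g (X F p i)) : f = g :=
  RingQuot.ringQuot_ext' F f g (FreeAlgebra.hom_ext (funext h))

/-- The product of the generators in a list. -/
def word (L : List ι) : SuperPoly F p := (L.map (X F p)).prod

/-- The homogeneous component of degree `d`, spanned by the products of `d` generators. -/
def degPart (d : ℕ) : Submodule F (SuperPoly F p) :=
  Submodule.span F (word F p '' {L | L.length = d})

/-- The component of parity `i`, spanned by the products of generators whose parities add up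
to `i`. -/
def gr (i : ZMod 2) : Submodule F (SuperPoly F p) :=
  Submodule.span F (word F p '' {L | (L.map p).sum = i})

theorem word_mem (L : List ι) : word F p L ∈ gr F p (L.map p).sum :=
  Submodule.subset_span ⟨L, rfl, rfl⟩

theorem X_mem (i : ι) : X F p i ∈ gr F p (p i) := by
  simpa [word] using word_mem F p [i]

instance : SetLike.GradedMonoid (gr F p) where
  one_mem := by simpa [word] using word_mem F p []
  mul_mem i j a b ha hb := by
    have h : gr F p i * gr F p j ≤ gr F p (i + j) := by
      rw [gr, gr, Submodule.span_mul_span, Submodule.span_le]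
      rintro _ ⟨_, ⟨L, hL, rfl⟩, _, ⟨L', hL', rfl⟩, rfl⟩
      have := word_mem F p (L ++ L')
      rw [List.map_append, List.sum_append, hL, hL'] at this
      simpa [word] using this
    exact h (Submodule.mul_mem_mul ha hb)

/-- The algebra homomorphism which decomposes elements by parity. -/
def decomp : SuperPoly F p →ₐ[F] ⨁ i, gr F p i :=
  lift (fun i => DirectSum.of (fun i => gr F p i) (p i) ⟨X F p i, X_mem F p i⟩) (by
    intro i j
    rw [DirectSum.of_mul_of, DirectSum.of_mul_of, Units.smul_def,
      ← map_zsmul (DirectSum.of (fun i => gr F p i) (p j + p i))]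
    refine DirectSum.of_eq_of_gradedMonoid_eq (Sigma.subtype_ext (add_comm _ _) ?_)
    exact X_mul_X F p i j)

theorem decomp_word (L : List ι) : decomp F p (word F p L) =
    DirectSum.of (fun i => gr F p i) (L.map p).sum ⟨word F p L, word_mem F p L⟩ := by
  induction L with
  | nil => exact map_one (decomp F p)
  | cons i L ih =>
    have e : word F p (i :: L) = X F p i * word F p L := by simp [word]
    have : decomp F p (word F p (i :: L)) = decomp F p (X F p i) * decomp F p (word F p L) := by
      rw [← map_mul, e]
    rw [this, ih, decomp, lift_X, DirectSum.of_mul_of]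
    exact DirectSum.of_eq_of_gradedMonoid_eq (Sigma.subtype_ext List.sum_cons.symm e.symm)

theorem decomp_mem (i : ZMod 2) (a : gr F p i) :
    decomp F p a = DirectSum.of (fun i => gr F p i) i a := by
  obtain ⟨a, ha⟩ := a
  induction ha using Submodule.span_induction with
  | mem x hx =>
    obtain ⟨L, rfl, rfl⟩ := hx
    exact decomp_word F p L
  | zero => exact (map_zero _).trans (map_zero _).symm
  | add x y hx hy ihx ihy =>
    simp only [map_add] at *
    rw [ihx, ihy, ← map_add]; rfl
  | smul c x hx ih =>
    simp only [map_smul] at *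
    rw [ih]
    exact (map_smul (DirectSum.lof F (ZMod 2) (fun i => gr F p i) i) c ⟨x, hx⟩).symm

instance : GradedAlgebra (gr F p) :=
  GradedAlgebra.ofAlgHom (gr F p) (decomp F p)
    (algHom_ext fun i => by
      rw [AlgHom.comp_apply, decomp, lift_X, DirectSum.coeAlgHom_of]; rfl)
    (decomp_mem F p)

end SuperPoly

end SuperPoly

section Supermodule

variable {F A B V : Type*} [Field F] [Ring A] [Algebra F A] [Coalgebra F A]
  [Ring B] [Algebra F B] [Coalgebra F B] [AddCommGroup V] [Module F V]

/-- A `G`-supermodule structure on `V`, for the affine supergroup `G` with coordinate Hopf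
superalgebra `H`: the structure of a right supercomodule, that is, a `ℤ/2`-grading on `V` together
with a coassociative and counital coaction `V → V ⊗ A` which is a morphism of superspaces. -/
structure Supermodule (H : HopfSuperalgebra F A) (V : Type*) [AddCommGroup V] [Module F V] where
  gr : ZMod 2 → Submodule F V
  isInternal : DirectSum.IsInternal gr
  coact : V →ₗ[F] V ⊗[F] A
  coact_even : ∀ (i : ZMod 2), ∀ v ∈ gr i, coact v ∈
    ⨆ j : ZMod 2, Submodule.map₂ (TensorProduct.mk F V A) (gr j) (H.gr (i - j))
  coassoc : ∀ v : V, TensorProduct.assoc F V A A (coact.rTensor A (coact v)) =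
    (Coalgebra.comul (R := F) (A := A)).lTensor V (coact v)
  counit_coact : ∀ v : V, (Coalgebra.counit (R := F) (A := A)).lTensor V (coact v) = v ⊗ₜ 1

/-- The restriction of a supermodule along a homomorphism `F[G] → F[G']` of Hopf superalgebras. -/
def Supermodule.restrict {H : HopfSuperalgebra F A} (M : Supermodule H V)
    (H' : HopfSuperalgebra F B) (π : A →ₐc[F] B)
    (hπ : ∀ (i : ZMod 2), ∀ a ∈ H.gr i, π a ∈ H'.gr i) : Supermodule H' V where
  gr := M.gr
  isInternal := M.isInternal
  coact := LinearMap.lTensor V (π : A →ₗ[F] B) ∘ₗ M.coact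
  coact_even i v hv := by
    have h : (⨆ j : ZMod 2, Submodule.map₂ (TensorProduct.mk F V A) (M.gr j) (H.gr (i - j))) ≤
        (⨆ j : ZMod 2, Submodule.map₂ (TensorProduct.mk F V B) (M.gr j) (H'.gr (i - j))).comap
          (LinearMap.lTensor V (π : A →ₗ[F] B)) := by
      refine iSup_le fun j => Submodule.map₂_le.mpr fun w hw a ha => ?_
      exact Submodule.mem_iSup_of_mem j (Submodule.apply_mem_map₂ _ hw (hπ _ a ha))
    exact h (M.coact_even i v hv)
  coassoc v := by
    have h1 : ∀ u : V ⊗[F] A, TensorProduct.assoc F V B B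
        ((LinearMap.lTensor V (π : A →ₗ[F] B) ∘ₗ M.coact).rTensor B
          (LinearMap.lTensor V (π : A →ₗ[F] B) u)) =
        LinearMap.lTensor V (TensorProduct.map (π : A →ₗ[F] B) (π : A →ₗ[F] B))
          (TensorProduct.assoc F V A A (M.coact.rTensor A u)) := by
      intro u
      induction u using TensorProduct.induction_on with
      | zero => simp
      | add u w hu hw => simp only [map_add, hu, hw]
      | tmul w a =>
        simp only [LinearMap.lTensor_tmul, LinearMap.rTensor_tmul, LinearMap.comp_apply]
        generalize M.coact w = t
        induction t using TensorProduct.induction_on with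
        | zero => simp
        | add u w hu hw => simp only [map_add, TensorProduct.add_tmul, hu, hw]
        | tmul w b => simp
    have h2 : ∀ u : V ⊗[F] A, (Coalgebra.comul (R := F) (A := B)).lTensor V
        (LinearMap.lTensor V (π : A →ₗ[F] B) u) =
        LinearMap.lTensor V (TensorProduct.map (π : A →ₗ[F] B) (π : A →ₗ[F] B))
          ((Coalgebra.comul (R := F) (A := A)).lTensor V u) := by
      intro u
      induction u using TensorProduct.induction_on with
      | zero => simp
      | add u w hu hw => simp only [map_add, hu, hw]
      | tmul w a =>
        simp only [LinearMap.lTensor_tmul]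
        exact congrArg (w ⊗ₜ ·) (CoalgHomClass.map_comp_comul_apply π a).symm
    rw [LinearMap.comp_apply, h1, h2, M.coassoc]
  counit_coact v := by
    rw [← M.counit_coact v, LinearMap.comp_apply]
    generalize M.coact v = u
    induction u using TensorProduct.induction_on with
    | zero => simp
    | add u w hu hw => simp only [map_add, hu, hw]
    | tmul w a =>
      simp only [LinearMap.lTensor_tmul]
      exact congrArg (w ⊗ₜ ·) (CoalgHomClass.counit_comp_apply π a)

/-- A homogeneous basis of a superspace, indexed by `ι`. -/
structure HomogBasis (gr : ZMod 2 → Submodule F V) (ι : Type*) where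
  basis : Module.Basis ι F V
  parity : ι → ZMod 2
  mem : ∀ i, basis i ∈ gr (parity i)

namespace Supermodule

variable {H : HopfSuperalgebra F A} (M : Supermodule H V) {ι : Type*} (b : HomogBasis M.gr ι)

/-- The coefficients `a_{ki}` of the coaction `τ(v_i) = ∑_k v_k ⊗ a_{ki}`. -/
def coef (k i : ι) : A :=
  TensorProduct.lid F A ((b.basis.coord k).rTensor A (M.coact (b.basis i)))

/-- The coefficients of the coaction `τ(x_i) = ∑_k x_k ⊗ (-1)^{|v_k|(|v_i|+|v_k|)} s(a_{ik})` on the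
dual basis `x_i` of `V*`. -/
def dualCoef (k i : ι) : A :=
  ((-1 : ℤˣ) ^ (b.parity k * (b.parity i + b.parity k))) • H.antipode (M.coef b i k)

theorem coord_eq_zero {i : ι} {j : ZMod 2} (hij : b.parity i ≠ j) {v : V} (hv : v ∈ M.gr j) :
    b.basis.coord i v = 0 := by
  classical
  let _ := M.isInternal.chooseDecomposition
  have h1 : ∀ w : V, b.basis.coord i (DirectSum.decompose M.gr w (b.parity i) : V) =
      b.basis.coord i w := by
    intro w
    have : b.basis.coord i ∘ₗ (M.gr (b.parity i)).subtype ∘ₗ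
        DirectSum.component F (ZMod 2) (fun j => M.gr j) (b.parity i) ∘ₗ
        (DirectSum.decomposeLinearEquiv M.gr).toLinearMap = b.basis.coord i := by
      refine b.basis.ext fun k => ?_
      change b.basis.coord i (DirectSum.decompose M.gr (b.basis k) (b.parity i) : V) =
        b.basis.coord i (b.basis k)
      by_cases hk : b.parity k = b.parity i
      · rw [DirectSum.decompose_of_mem_same M.gr (hk ▸ b.mem k)]
      · have hki : k ≠ i := fun h => hk (congrArg _ h)
        rw [DirectSum.decompose_of_mem_ne M.gr (b.mem k) hk, map_zero]
        simp [hki]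
    exact LinearMap.congr_fun this w
  rw [← h1 v, DirectSum.decompose_of_mem_ne M.gr hv hij.symm, map_zero]

theorem coef_mem (k i : ι) : M.coef b k i ∈ H.gr (b.parity i + b.parity k) := by
  have h : (⨆ j : ZMod 2, Submodule.map₂ (TensorProduct.mk F V A) (M.gr j)
      (H.gr (b.parity i - j))) ≤ (H.gr (b.parity i + b.parity k)).comap
        ((TensorProduct.lid F A).toLinearMap ∘ₗ (b.basis.coord k).rTensor A) := by
    refine iSup_le fun j => Submodule.map₂_le.mpr fun w hw a ha => ?_
    by_cases hj : b.parity k = j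
    · subst hj
      have e : b.parity i - b.parity k = b.parity i + b.parity k := by
        generalize b.parity i = s; generalize b.parity k = t; revert s t; decide
      rw [e] at ha
      simpa using Submodule.smul_mem _ _ ha
    · have := M.coord_eq_zero b hj hw
      simp only [Module.Basis.coord_apply] at this
      simp [this]
  exact h (M.coact_even _ _ (b.mem i))

theorem dualCoef_mem (k i : ι) : M.dualCoef b k i ∈ H.gr (b.parity i + b.parity k) := by
  rw [dualCoef, Units.smul_def]
  refine zsmul_mem (H.antipode_even _ _ ?_) _
  rw [add_comm]
  exact M.coef_mem b i k

theorem gen_comm [Fintype ι] (i j : ι) :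
    (∑ k, GradedTensorProduct.of F (SuperPoly.gr F b.parity) H.gr
      (SuperPoly.X F b.parity k ⊗ₜ M.dualCoef b k i)) *
    (∑ k, GradedTensorProduct.of F (SuperPoly.gr F b.parity) H.gr
      (SuperPoly.X F b.parity k ⊗ₜ M.dualCoef b k j)) =
    ((-1 : ℤˣ) ^ (b.parity i * b.parity j)) •
    ((∑ k, GradedTensorProduct.of F (SuperPoly.gr F b.parity) H.gr
      (SuperPoly.X F b.parity k ⊗ₜ M.dualCoef b k j)) *
    (∑ k, GradedTensorProduct.of F (SuperPoly.gr F b.parity) H.gr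
      (SuperPoly.X F b.parity k ⊗ₜ M.dualCoef b k i))) := by
  rw [Finset.sum_mul_sum, Finset.sum_mul_sum, Finset.sum_comm, Finset.smul_sum]
  refine Finset.sum_congr rfl fun l _ => ?_
  rw [Finset.smul_sum]
  refine Finset.sum_congr rfl fun k _ => ?_
  rw [gradedTensor_mul _ _ _ (M.dualCoef_mem b k i) (SuperPoly.X_mem F b.parity l),
    gradedTensor_mul _ _ _ (M.dualCoef_mem b l j) (SuperPoly.X_mem F b.parity k),
    SuperPoly.X_mul_X F b.parity k l,
    H.supercomm _ _ _ _ (M.dualCoef_mem b k i) (M.dualCoef_mem b l j)]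
  simp only [Units.smul_def, TensorProduct.tmul_smul, ← TensorProduct.smul_tmul', map_zsmul,
    smul_smul]
  congr 1
  generalize b.parity i = s
  generalize b.parity j = t
  generalize b.parity k = u
  generalize b.parity l = v
  revert s t u v
  decide

/-- The coaction `τ : F[V] → F[V] ⊗ F[G]` on the polynomial superalgebra `F[V]`, the homomorphism
of superalgebras with `τ(x_i) = ∑_k x_k ⊗ (-1)^{|v_k|(|v_i|+|v_k|)} s(a_{ik})`. -/
def polyCoact [Fintype ι] : SuperPoly F b.parity →ₐ[F]
    GradedTensorProduct F (SuperPoly.gr F b.parity) H.gr :=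
  SuperPoly.lift (fun i => ∑ k, GradedTensorProduct.of F (SuperPoly.gr F b.parity) H.gr
    (SuperPoly.X F b.parity k ⊗ₜ M.dualCoef b k i)) (M.gen_comm b)

/-- `f ∈ F[V]` is an (absolute) invariant if `τ(f) = f ⊗ 1`. -/
def IsInvariant [Fintype ι] (f : SuperPoly F b.parity) : Prop :=
  M.polyCoact b f = GradedTensorProduct.of F (SuperPoly.gr F b.parity) H.gr (f ⊗ₜ 1)

/-- `M_{G,V}`: the minimal positive degree in which there is a non-zero homogeneous invariant
of `G` in `F[V]`, and `∞` if there is none. -/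
def minDeg [Fintype ι] : ℕ∞ :=
  ⨅ (d : ℕ) (_ : 0 < d ∧ ∃ f ∈ SuperPoly.degPart F b.parity d, f ≠ 0 ∧ M.IsInvariant b f), (d : ℕ∞)

end Supermodule

end Supermodule

/-- The condition that `V*` is the direct sum of the supermodules `L(h_1), …, L(h_s)`, for the dual
basis `f_{j,0}` (even), `f_{j,1}` (odd), `1 ≤ j ≤ s`, of the given basis of `V`:
`τ(f_{j,0}) = f_{j,0} ⊗ h_j + x(h_j) f_{j,1} ⊗ h_j g z` and
`τ(f_{j,1}) = f_{j,0} ⊗ h_j z + f_{j,1} ⊗ h_j g`. -/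
def Supermodule.DualIsSumL {F X V : Type*} [Field F] [NeZero (2 : F)] [CommGroup X]
    [AddCommGroup V] [Module F V] {P : SuperPair F X} (M : Supermodule (CoordAlg.hopf P) V)
    {ι : Type*} [Fintype ι] (b : HomogBasis M.gr ι) : Prop :=
  ∃ (s : ℕ) (e : Fin s × Fin 2 ≃ ι) (h : Fin s → X), ∀ j : Fin s,
    b.parity (e (j, 0)) = 0 ∧ b.parity (e (j, 1)) = 1 ∧
    M.polyCoact b (SuperPoly.X F b.parity (e (j, 0))) =
      GradedTensorProduct.of F (SuperPoly.gr F b.parity) (CoordAlg.hopf P).gr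
        (SuperPoly.X F b.parity (e (j, 0)) ⊗ₜ CoordAlg.el P (h j) +
          P.x (Additive.ofMul (h j)) •
            (SuperPoly.X F b.parity (e (j, 1)) ⊗ₜ CoordAlg.elz P (h j * P.g))) ∧
    M.polyCoact b (SuperPoly.X F b.parity (e (j, 1))) =
      GradedTensorProduct.of F (SuperPoly.gr F b.parity) (CoordAlg.hopf P).gr
        (SuperPoly.X F b.parity (e (j, 0)) ⊗ₜ CoordAlg.elz P (h j) +
          SuperPoly.X F b.parity (e (j, 1)) ⊗ₜ CoordAlg.el P (h j * P.g))

/-- A `D_{g,x}`-supermodule, restricted to `D'`. -/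
def Supermodule.restrictKer {F X V : Type*} [Field F] [NeZero (2 : F)] [CommGroup X]
    [AddCommGroup V] [Module F V] {P : SuperPair F X} (M : Supermodule (CoordAlg.hopf P) V) :
    Supermodule P.kerHopf V :=
  M.restrict P.kerHopf P.restrictHom P.restrictHom_even

end

/-! The lower bound is restriction: the map `F[D_{g,x}] → F[D']` turns an invariant of `D_{g,x}`
into an invariant of `D'` of the same degree.

For the upper bound, each `F[V]_d` is spanned by weight vectors `a` for `D`, each with a companion
`a'` of opposite parity such that `τ(a) = a ⊗ h + a' ⊗ hgz` and `τ(a') = a' ⊗ hg + x(h) a ⊗ hz`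
(`degPart_le_weightSpan`). On generators this comes from comultiplying matrix coefficients
(`weightPair_X`). It passes to products because `a ↦ a'` is an odd superderivation
(`IsWeightPair.mul`). Characteristic not 2 gives `x(g) = 0`. So if `a` has weight `g`, then `τ(a') =
a' ⊗ g² = a' ⊗ 1`: companions of vectors of weight `g` are invariant
(`IsWeightPair.isInvariant_snd`). Moreover, a non-zero `D'`-invariant in a span of weight vectors
forces one of them to be non-zero with weight in `⟨g⟩` (`exists_mem_zpowers_of_isInvariant`).

(a) If `D` is connected, the idempotent `(1 + g)/2` is trivial, so `g = 1`. A `D'`-invariant of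
degree `d` then yields a non-zero `a` of weight `1 = g`. Either `a' = 0` and `a` is invariant, or
`a'` is a non-zero invariant. The two minimal degrees even coincide.

(b) The generators `f_{j,0}`, `f_{j,1}` have weights `h_j`, `h_j g`, so some word of length `d` has
weight in `⟨g⟩`. Replacing every letter by its even partner changes the weight by a power of `g`,
and writing the new word twice gives an even word `f_{j,0} w` of length `2d` and weight `1`. Then
`f_{j,1} w` has weight `g`, and its companion `f_{j,1} w' + f_{j,0} w` is an invariant of degree
`2d`. It is non-zero because killing the odd generators leaves a monomial. -/

noncomputable section

namespace Supermodule

/-! ### Matrix coefficients of the coaction and of its dual. -/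

section Coefficients

variable {F A V ι : Type*} [Field F] [Ring A] [Algebra F A] [Coalgebra F A]
  [AddCommGroup V] [Module F V] {H : HopfSuperalgebra F A} (M : Supermodule H V)
  (b : HomogBasis M.gr ι)

theorem coact_basis [Fintype ι] (i : ι) :
    M.coact (b.basis i) = ∑ k, b.basis k ⊗ₜ M.coef b k i := by
  have h : ∀ u : V ⊗[F] A, u = ∑ k, b.basis k ⊗ₜ
      TensorProduct.lid F A ((b.basis.coord k).rTensor A u) := by
    intro u
    induction u using TensorProduct.induction_on with
    | zero => simp
    | add u w hu hw =>
      conv_lhs => rw [hu, hw]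
      simp only [map_add, TensorProduct.tmul_add, Finset.sum_add_distrib]
    | tmul v a =>
      simp only [LinearMap.rTensor_tmul, TensorProduct.lid_tmul, TensorProduct.tmul_smul,
        TensorProduct.smul_tmul', ← TensorProduct.sum_tmul]
      congr 1
      exact (b.basis.sum_repr v).symm
  exact h _

theorem comul_coef [Fintype ι] (k i : ι) :
    Coalgebra.comul (R := F) (M.coef b k i) = ∑ l, M.coef b k l ⊗ₜ M.coef b l i := by
  classical
  have h := congrArg (fun u => TensorProduct.lid F (A ⊗[F] A)
    ((b.basis.coord k).rTensor (A ⊗[F] A) u)) (M.coassoc (b.basis i))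
  simp only [M.coact_basis b, map_sum, LinearMap.rTensor_tmul, LinearMap.lTensor_tmul,
    TensorProduct.sum_tmul, TensorProduct.assoc_tmul, TensorProduct.lid_tmul,
    Module.Basis.coord_apply, Module.Basis.repr_self, Finsupp.single_apply, ite_smul, one_smul,
    zero_smul, Finset.sum_ite_eq', Finset.mem_univ, if_true] at h
  simpa using h.symm

theorem counit_coef [Fintype ι] [DecidableEq ι] (k i : ι) :
    Coalgebra.counit (R := F) (M.coef b k i) = if k = i then 1 else 0 := by
  have h := congrArg (fun u => TensorProduct.lid F F
    ((b.basis.coord k).rTensor F u)) (M.counit_coact (b.basis i))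
  simp only [M.coact_basis b, map_sum, LinearMap.rTensor_tmul, LinearMap.lTensor_tmul,
    TensorProduct.lid_tmul, Module.Basis.coord_apply, Module.Basis.repr_self,
    Finsupp.single_apply, ite_smul, one_smul, zero_smul, Finset.sum_ite_eq', Finset.mem_univ,
    if_true] at h
  simpa [eq_comm] using h

/-- The antipode reverses the two factors of `comul_coef` up to the sign of the supersymmetry. The
transposition in `dualCoef` restores the order, and its sign absorbs the other one. Hence the dual
coefficients again form a comatrix. -/
theorem comul_dualCoef [Fintype ι] (k i : ι) :
    Coalgebra.comul (R := F) (M.dualCoef b k i) =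
      ∑ l, M.dualCoef b k l ⊗ₜ M.dualCoef b l i := by
  refine (GradedTensorProduct.of F H.gr H.gr).injective ?_
  have e : ∀ l, GradedTensorProduct.comm H.gr H.gr (GradedTensorProduct.of F H.gr H.gr
      (H.antipode (M.coef b i l) ⊗ₜ H.antipode (M.coef b l k))) =
      ((-1 : ℤˣ) ^ ((b.parity k + b.parity l) * (b.parity l + b.parity i))) •
      GradedTensorProduct.of F H.gr H.gr
        (H.antipode (M.coef b l k) ⊗ₜ H.antipode (M.coef b i l)) := fun l =>
    GradedTensorProduct.comm_coe_tmul_coe H.gr H.gr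
      ⟨_, H.antipode_even _ _ (M.coef_mem b i l)⟩ ⟨_, H.antipode_even _ _ (M.coef_mem b l k)⟩ |>.trans
      (by rw [mul_comm])
  simp only [dualCoef, Units.smul_def, map_zsmul, H.comul_antipode, M.comul_coef, map_sum,
    TensorProduct.map_tmul, AlgHom.toLinearMap_apply, e, Finset.smul_sum]
  refine Finset.sum_congr rfl fun l _ => ?_
  simp only [Units.smul_def, TensorProduct.tmul_smul, ← TensorProduct.smul_tmul', map_zsmul,
    smul_smul]
  congr 1
  -- What is left is an identity of signs in three parities, checked over all eight cases.
  generalize b.parity i = s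
  generalize b.parity k = t
  generalize b.parity l = u
  revert s t u
  decide

end Coefficients

end Supermodule

/-! ### Degrees, and the quotient of `F[V]` by the odd generators. -/

namespace SuperPoly

variable (F : Type*) [Field F] {ι : Type*} (p : ι → ZMod 2)

theorem word_cons (i : ι) (L : List ι) : word F p (i :: L) = X F p i * word F p L := by
  simp [word]

theorem X_mem_degPart (i : ι) : X F p i ∈ degPart F p 1 :=
  Submodule.subset_span ⟨[i], rfl, by simp [word]⟩

theorem mul_mem_degPart {m n : ℕ} {a b : SuperPoly F p} (ha : a ∈ degPart F p m)
    (hb : b ∈ degPart F p n) : a * b ∈ degPart F p (m + n) := by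
  have h : degPart F p m * degPart F p n ≤ degPart F p (m + n) := by
    rw [degPart, degPart, Submodule.span_mul_span, Submodule.span_le]
    rintro _ ⟨_, ⟨L, hL, rfl⟩, _, ⟨L', hL', rfl⟩, rfl⟩
    rw [Set.mem_ofPred_eq] at hL hL'
    exact Submodule.subset_span ⟨L ++ L', by simp [hL, hL'], by simp [word]⟩
  exact h (Submodule.mul_mem_mul ha hb)

/-- The homomorphism onto the polynomial algebra in the even generators, which annihilates the odd
generators. -/
def evenHom : SuperPoly F p →ₐ[F] MvPolynomial ι F :=
  lift (fun i => if p i = 0 then MvPolynomial.X i else 0) (by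
    intro i j
    rcases CoordAlg.zmod2_cases (p i) with hi | hi <;>
      rcases CoordAlg.zmod2_cases (p j) with hj | hj <;> simp [hi, hj, mul_comm])

theorem evenHom_X_even {i : ι} (hi : p i = 0) : evenHom F p (X F p i) = MvPolynomial.X i := by
  simp [evenHom, hi]

theorem evenHom_X_odd {i : ι} (hi : p i = 1) : evenHom F p (X F p i) = 0 := by
  simp [evenHom, hi]

/-- The image is a monomial in a domain. This is how the invariant built in case (b) is seen to be
non-zero. -/
theorem evenHom_word_ne_zero (L : List ι) (hL : ∀ i ∈ L, p i = 0) :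
    evenHom F p (word F p L) ≠ 0 := by
  induction L with
  | nil => simp [word]
  | cons i L ih =>
    rw [word_cons, map_mul, evenHom_X_even F p (hL i (by simp))]
    exact mul_ne_zero (MvPolynomial.X_ne_zero i) (ih fun j hj => hL j (by simp [hj]))

end SuperPoly

/-- The sign rule for products needs the degrees of the factors, so multiplicativity is tested on
tensors of homogeneous elements. -/
theorem GradedTensorProduct.induction_homogeneous {F A B : Type*} [Field F] [Ring A] [Ring B]
    [Algebra F A] [Algebra F B] (𝒜 : ZMod 2 → Submodule F A) (ℬ : ZMod 2 → Submodule F B)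
    [GradedAlgebra 𝒜] [GradedAlgebra ℬ] {p : GradedTensorProduct F 𝒜 ℬ → Prop}
    (h0 : p 0) (hadd : ∀ u v, p u → p v → p (u + v))
    (h : ∀ i j, ∀ a ∈ 𝒜 i, ∀ c ∈ ℬ j, p (GradedTensorProduct.of F 𝒜 ℬ (a ⊗ₜ c)))
    (u : GradedTensorProduct F 𝒜 ℬ) : p u := by
  obtain ⟨u, rfl⟩ := (GradedTensorProduct.of F 𝒜 ℬ).surjective u
  induction u using TensorProduct.induction_on with
  | zero => rwa [map_zero]
  | add u v hu hv => rw [map_add]; exact hadd _ _ hu hv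
  | tmul a c =>
    induction a using DirectSum.Decomposition.inductionOn 𝒜 with
    | zero => rwa [TensorProduct.zero_tmul, map_zero]
    | add a a' ha ha' => rw [TensorProduct.add_tmul, map_add]; exact hadd _ _ ha ha'
    | homogeneous a =>
      induction c using DirectSum.Decomposition.inductionOn ℬ with
      | zero => rwa [TensorProduct.tmul_zero, map_zero]
      | add c c' hc hc' => rw [TensorProduct.tmul_add, map_add]; exact hadd _ _ hc hc'
      | homogeneous c => exact h _ _ _ a.2 _ c.2

/-! ### Restriction to `D'` and the lower bound. -/

namespace Supermodule

section Restriction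

variable {F X V ι : Type*} [Field F] [NeZero (2 : F)] [CommGroup X]
  [AddCommGroup V] [Module F V] {P : SuperPair F X}
  (M : Supermodule (CoordAlg.hopf P) V) (b : HomogBasis M.gr ι)

/-- Needed because the coaction on the dual basis involves the antipode; on the elements `hz` both
sides vanish. -/
theorem restrictHom_antipode (a : CoordAlg P) :
    P.restrictHom ((CoordAlg.hopf P).antipode a) = P.kerHopf.antipode (P.restrictHom a) := by
  have e : ∀ h : X, P.kerHopf.antipode
      (Ideal.Quotient.mk P.kerIdeal (MonoidAlgebra.single h (1 : F))) =
      Ideal.Quotient.mk P.kerIdeal (MonoidAlgebra.single h⁻¹ (1 : F)) := fun h => by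
    change HopfAlgebra.antipode F (Ideal.Quotient.mk P.kerIdeal _) = _
    simp [HopfAlgebra.Quotient.antipode_mk]
  induction a using CoordAlg.induction with
  | h1 h =>
    change P.restrictAlgHom (CoordAlg.antipodeLin P _) = P.kerHopf.antipode (P.restrictAlgHom _)
    rw [CoordAlg.antipodeLin_el, P.restrictAlgHom_el, P.restrictAlgHom_el, e]
  | h2 h =>
    change P.restrictAlgHom (CoordAlg.antipodeLin P _) = P.kerHopf.antipode (P.restrictAlgHom _)
    rw [CoordAlg.antipodeLin_elz, map_neg, P.restrictAlgHom_elz, P.restrictAlgHom_elz, neg_zero,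
      map_zero]
  | h3 a c ha hc => simp only [map_add, ha, hc]
  | h4 r a ha => simp only [map_smul, ha]

theorem restrictKer_dualCoef (k i : ι) :
    M.restrictKer.dualCoef b k i = P.restrictHom (M.dualCoef b k i) := by
  have e : ∀ k i, M.restrictKer.coef b k i = P.restrictHom (M.coef b k i) := by
    intro k i
    change TensorProduct.lid F P.KerCoord ((b.basis.coord k).rTensor P.KerCoord
      (LinearMap.lTensor V (P.restrictHom : CoordAlg P →ₗ[F] P.KerCoord)
        (M.coact (b.basis i)))) = _
    rw [coef]
    generalize M.coact (b.basis i) = u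
    induction u using TensorProduct.induction_on with
    | zero => simp
    | add u w hu hw => simp only [map_add, hu, hw]
    | tmul v a => simp
  change ((-1 : ℤˣ) ^ (b.parity k * (b.parity i + b.parity k))) •
    P.kerHopf.antipode (M.restrictKer.coef b i k) = _
  rw [dualCoef, e, ← restrictHom_antipode, Units.smul_def, Units.smul_def, map_zsmul]

/-- The map `F[V] ⊗ F[D_{g,x}] → F[V] ⊗ F[D']` given by restriction to `D'`. -/
def restrictTensor (P : SuperPair F X) (p : ι → ZMod 2) :
    GradedTensorProduct F (SuperPoly.gr F p) (CoordAlg.hopf P).gr →ₗ[F]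
      GradedTensorProduct F (SuperPoly.gr F p) P.kerHopf.gr :=
  (GradedTensorProduct.of F (SuperPoly.gr F p) P.kerHopf.gr).toLinearMap ∘ₗ
    (LinearMap.lTensor (SuperPoly F p) (P.restrictHom : CoordAlg P →ₗ[F] P.KerCoord)) ∘ₗ
    (GradedTensorProduct.of F (SuperPoly.gr F p) (CoordAlg.hopf P).gr).symm.toLinearMap

@[simp] theorem restrictTensor_of (p : ι → ZMod 2) (a : SuperPoly F p) (c : CoordAlg P) :
    restrictTensor P p
      (GradedTensorProduct.of F (SuperPoly.gr F p) (CoordAlg.hopf P).gr (a ⊗ₜ c)) =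
      GradedTensorProduct.of F (SuperPoly.gr F p) P.kerHopf.gr (a ⊗ₜ P.restrictHom c) := rfl

/-- Restriction preserves parity, so the same signs occur before and after it. -/
theorem restrictTensor_mul (p : ι → ZMod 2)
    (u v : GradedTensorProduct F (SuperPoly.gr F p) (CoordAlg.hopf P).gr) :
    restrictTensor P p (u * v) = restrictTensor P p u * restrictTensor P p v := by
  induction u using GradedTensorProduct.induction_homogeneous with
  | h0 => simp
  | hadd u w hu hw => simp only [add_mul, map_add, hu, hw]
  | h i j a ha c hc =>
    induction v using GradedTensorProduct.induction_homogeneous with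
    | h0 => simp
    | hadd u w hu hw => simp only [mul_add, map_add, hu, hw]
    | h i' j' a' ha' c' hc' =>
      rw [gradedTensor_mul _ _ _ hc ha', Units.smul_def, map_zsmul]
      simp only [restrictTensor_of]
      rw [gradedTensor_mul _ _ _ (P.restrictHom_even _ _ hc) ha', Units.smul_def, map_mul]

variable [Fintype ι]

theorem restrictKer_polyCoact (f : SuperPoly F b.parity) :
    M.restrictKer.polyCoact b f = restrictTensor P b.parity (M.polyCoact b f) := by
  -- Both sides are algebra homomorphisms in `f`, so comparing them on generators suffices.
  let φ : SuperPoly F b.parity →ₐ[F]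
      GradedTensorProduct F (SuperPoly.gr F b.parity) P.kerHopf.gr :=
    (AlgHom.ofLinearMap (restrictTensor P b.parity)
      (by
        have := restrictTensor_of (P := P) b.parity 1 1
        rwa [map_one] at this)
      (restrictTensor_mul b.parity)).comp (M.polyCoact b)
  have : M.restrictKer.polyCoact b = φ := SuperPoly.algHom_ext fun i => by
    change _ = restrictTensor P b.parity (M.polyCoact b _)
    simp only [polyCoact, SuperPoly.lift_X, map_sum, restrictTensor_of, restrictKer_dualCoef]
  exact DFunLike.congr_fun this f

theorem IsInvariant.restrictKer {f : SuperPoly F b.parity} (hf : M.IsInvariant b f) :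
    M.restrictKer.IsInvariant b f := by
  change M.restrictKer.polyCoact b f = _
  rw [restrictKer_polyCoact, hf]
  simp

theorem restrictKer_minDeg_le : M.restrictKer.minDeg b ≤ M.minDeg b := by
  refine le_iInf₂ fun d hd => iInf₂_le d ?_
  obtain ⟨h0, f, hf, hf0, hi⟩ := hd
  exact ⟨h0, f, hf, hf0, hi.restrictKer M b⟩

end Restriction

end Supermodule

/-! ### Coefficient functionals on `F[D_{g,x}]`. -/

namespace CoordAlg

variable {F X : Type*} [Field F] [CommGroup X] (P : SuperPair F X)

/-- The coefficient at the basis element `h`. -/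
def evenCoeff (h : X) : CoordAlg P →ₗ[F] F := by
  classical exact liftLin P (fun k => if k = h then 1 else 0) (fun _ => 0)

/-- The coefficient at the basis element `hz`. -/
def oddCoeff (h : X) : CoordAlg P →ₗ[F] F := by
  classical exact liftLin P (fun _ => 0) (fun k => if k = h then 1 else 0)

open Classical in
@[simp] theorem evenCoeff_el (h k : X) : evenCoeff P h (el P k) = if k = h then 1 else 0 :=
  liftLin_el P _ _ k

@[simp] theorem evenCoeff_elz (h k : X) : evenCoeff P h (elz P k) = 0 :=
  liftLin_elz P _ _ k

@[simp] theorem oddCoeff_el (h k : X) : oddCoeff P h (el P k) = 0 :=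
  liftLin_el P _ _ k

open Classical in
@[simp] theorem oddCoeff_elz (h k : X) : oddCoeff P h (elz P k) = if k = h then 1 else 0 :=
  liftLin_elz P _ _ k

theorem evenCoeff_of_mem {i : ZMod 2} {a : CoordAlg P} (ha : a ∈ gr P i) (hi : i = 1) (h : X) :
    evenCoeff P h a = 0 := by
  refine gr_induction P (p := fun i a => i = 1 → evenCoeff P h a = 0) ?_ ?_ ?_ ?_ ?_ ha hi
  · intro h h0; exact absurd h0 (by decide)
  · intro h _; simp
  · intro i _; simp
  · intro i a b h1 h2 hi; rw [map_add, h1 hi, h2 hi, add_zero]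
  · intro i c a h1 hi; rw [map_smul, h1 hi, smul_zero]

theorem oddCoeff_of_mem {i : ZMod 2} {a : CoordAlg P} (ha : a ∈ gr P i) (hi : i = 0) (h : X) :
    oddCoeff P h a = 0 := by
  refine gr_induction P (p := fun i a => i = 0 → oddCoeff P h a = 0) ?_ ?_ ?_ ?_ ?_ ha hi
  · intro h _; simp
  · intro h h0; exact absurd h0 (by decide)
  · intro i _; simp
  · intro i a b h1 h2 hi; rw [map_add, h1 hi, h2 hi, add_zero]
  · intro i c a h1 hi; rw [map_smul, h1 hi, smul_zero]

variable [NeZero (2 : F)]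

/-- The counit sums the coefficients at all `h`. Allowing every larger `T` lets one finite set serve
several elements at once. -/
theorem exists_counit_eq_sum (a : CoordAlg P) : ∃ S : Finset X, ∀ T, S ⊆ T →
    Coalgebra.counit (R := F) a = ∑ h ∈ T, evenCoeff P h a := by
  classical
  induction a using CoordAlg.induction with
  | h1 h => exact ⟨{h}, fun T hT => by simp [Finset.singleton_subset_iff.mp hT]⟩
  | h2 h => exact ⟨∅, fun T _ => by simp⟩
  | h3 a b ha hb =>
    obtain ⟨S, hS⟩ := ha
    obtain ⟨S', hS'⟩ := hb
    refine ⟨S ∪ S', fun T hT => ?_⟩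
    simp only [map_add, Finset.sum_add_distrib, hS T (Finset.union_subset_left hT),
      hS' T (Finset.union_subset_right hT)]
  | h4 c a ha =>
    obtain ⟨S, hS⟩ := ha
    exact ⟨S, fun T hT => by simp only [map_smul, hS T hT, Finset.smul_sum]⟩

/-- In `Δ`, the right factor `h` occurs only in `Δ(h)`, beside `h`, and in `Δ(hgz)`, beside `hgz`
since `g² = 1`. This becomes the formula for `τ(a)` of a weight pair. -/
theorem rid_comul_evenCoeff (hg : P.g ^ 2 = 1) (h : X) (a : CoordAlg P) :
    TensorProduct.rid F _ ((evenCoeff P h).lTensor _ (Coalgebra.comul (R := F) a)) =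
      evenCoeff P h a • el P h + oddCoeff P (h * P.g) a • elz P (h * P.g) := by
  classical
  rw [pow_two] at hg
  have e : ∀ k, k * P.g = h ↔ k = h * P.g := fun k =>
    ⟨fun h => by rw [← h, mul_assoc, hg, mul_one], fun h => by rw [h, mul_assoc, hg, mul_one]⟩
  induction a using CoordAlg.induction with
  | h1 k => by_cases hk : k = h <;> simp [hk]
  | h2 k => by_cases hk : k = h * P.g <;> simp [hk, e, mul_assoc, hg]
  | h3 a b ha hb => simp only [map_add, ha, hb, add_smul]; abel
  | h4 c a ha => simp only [map_smul, ha, smul_add, smul_smul, smul_eq_mul]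

/-- Likewise the right factor `hgz` occurs only in `Δ(hgz)`, beside `hg`, and in `Δ(h)`, beside
`x(h) hz`. This becomes the formula for `τ(a')`. -/
theorem rid_comul_oddCoeff (h : X) (a : CoordAlg P) :
    TensorProduct.rid F _ ((oddCoeff P (h * P.g)).lTensor _ (Coalgebra.comul (R := F) a)) =
      oddCoeff P (h * P.g) a • el P (h * P.g) +
        (P.x (Additive.ofMul h) * evenCoeff P h a) • elz P h := by
  classical
  induction a using CoordAlg.induction with
  | h1 k => by_cases hk : k = h <;> simp [hk]
  | h2 k => by_cases hk : k = h * P.g <;> simp [hk]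
  | h3 a b ha hb => simp only [map_add, ha, hb, add_smul, mul_add]; abel
  | h4 c a ha =>
    simp only [map_smul, ha, smul_add, smul_smul, smul_eq_mul, mul_left_comm]

end CoordAlg

/-! ### Weight vectors and their companions. -/

namespace Supermodule

variable {F X V ι : Type*} [Field F] [NeZero (2 : F)] [CommGroup X]
  [AddCommGroup V] [Module F V] [Fintype ι] {P : SuperPair F X}
  (M : Supermodule (CoordAlg.hopf P) V) (b : HomogBasis M.gr ι)

/-- `a ∈ F[V]` is homogeneous of degree `d`, of parity `i` and of weight `h` for the action of `D`,
and `a'` is its image under the odd superderivation of `F[V]` given by the coefficients of the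
coaction at the elements `kz`. -/
structure IsWeightPair (h : X) (i : ZMod 2) (d : ℕ) (a a' : SuperPoly F b.parity) : Prop where
  mem_gr : a ∈ SuperPoly.gr F b.parity i
  mem_gr' : a' ∈ SuperPoly.gr F b.parity (i + 1)
  mem_degPart : a ∈ SuperPoly.degPart F b.parity d
  mem_degPart' : a' ∈ SuperPoly.degPart F b.parity d
  coact : M.polyCoact b a = GradedTensorProduct.of F (SuperPoly.gr F b.parity) (CoordAlg.hopf P).gr
    (a ⊗ₜ CoordAlg.el P h + a' ⊗ₜ CoordAlg.elz P (h * P.g))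
  coact' : M.polyCoact b a' =
    GradedTensorProduct.of F (SuperPoly.gr F b.parity) (CoordAlg.hopf P).gr
      (a' ⊗ₜ CoordAlg.el P (h * P.g) + P.x (Additive.ofMul h) • (a ⊗ₜ CoordAlg.elz P h))

namespace IsWeightPair

variable {M b}

theorem one : M.IsWeightPair b 1 0 0 1 0 where
  mem_gr := SetLike.GradedOne.one_mem
  mem_gr' := zero_mem _
  mem_degPart := Submodule.subset_span ⟨[], rfl, rfl⟩
  mem_degPart' := zero_mem _
  coact := by
    rw [map_one, TensorProduct.zero_tmul, add_zero]
    rfl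
  coact' := by simp

/-- The super Leibniz rule: the sign arises when the `z` coming from `a` passes `c`. The product of
the two terms in `z` vanishes because `z² = 0`. -/
theorem mul (hg : P.g ^ 2 = 1) {h k : X} {i j : ZMod 2} {m n : ℕ} {a a' c c' : SuperPoly F b.parity}
    (ha : M.IsWeightPair b h i m a a') (hc : M.IsWeightPair b k j n c c') :
    M.IsWeightPair b (h * k) (i + j) (m + n) (a * c)
      (a * c' + ((-1 : ℤˣ) ^ j) • (a' * c)) where
  mem_gr := SetLike.GradedMul.mul_mem ha.mem_gr hc.mem_gr
  mem_gr' := by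
    refine add_mem ?_ ?_
    · rw [add_assoc]
      exact SetLike.GradedMul.mul_mem ha.mem_gr hc.mem_gr'
    · rw [Units.smul_def]
      refine zsmul_mem ?_ _
      rw [add_right_comm]
      exact SetLike.GradedMul.mul_mem ha.mem_gr' hc.mem_gr
  mem_degPart := SuperPoly.mul_mem_degPart F _ ha.mem_degPart hc.mem_degPart
  mem_degPart' := by
    refine add_mem (SuperPoly.mul_mem_degPart F _ ha.mem_degPart hc.mem_degPart') ?_
    rw [Units.smul_def]
    exact zsmul_mem (SuperPoly.mul_mem_degPart F _ ha.mem_degPart' hc.mem_degPart) _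
  coact := by
    have el_mem : ∀ k, CoordAlg.el P k ∈ (CoordAlg.hopf P).gr 0 := CoordAlg.el_mem P
    have elz_mem : ∀ k, CoordAlg.elz P k ∈ (CoordAlg.hopf P).gr 1 := CoordAlg.elz_mem P
    rw [map_mul, ha.coact, hc.coact]
    simp only [map_add, add_mul, mul_add, gradedTensor_mul _ _ _ (el_mem _) hc.mem_gr,
      gradedTensor_mul _ _ _ (elz_mem _) hc.mem_gr, gradedTensor_mul _ _ _ (el_mem _) hc.mem_gr',
      gradedTensor_mul _ _ _ (elz_mem _) hc.mem_gr', CoordAlg.el_mul_el, CoordAlg.el_mul_elz,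
      CoordAlg.elz_mul_el, CoordAlg.elz_mul_elz, TensorProduct.tmul_zero, map_zero, smul_zero,
      add_zero, TensorProduct.add_tmul]
    simp only [Units.smul_def, ← TensorProduct.smul_tmul', map_zsmul, zero_mul, one_mul,
      uzpow_zero, Units.val_one, one_smul, ← mul_assoc, mul_right_comm _ P.g, zero_add, add_zero]
    abel
  coact' := by
    have el_mem : ∀ k, CoordAlg.el P k ∈ (CoordAlg.hopf P).gr 0 := CoordAlg.el_mem P
    have elz_mem : ∀ k, CoordAlg.elz P k ∈ (CoordAlg.hopf P).gr 1 := CoordAlg.elz_mem P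
    have e : ∀ l : X, l * P.g * P.g = l := fun l => by
      rw [mul_assoc, ← pow_two, hg, mul_one]
    rw [map_add, Units.smul_def, map_zsmul, map_mul, map_mul, ha.coact, hc.coact', ha.coact',
      hc.coact]
    simp only [map_add, add_mul, mul_add, map_smul, smul_mul_assoc, mul_smul_comm,
      gradedTensor_mul _ _ _ (el_mem _) hc.mem_gr,
      gradedTensor_mul _ _ _ (elz_mem _) hc.mem_gr, gradedTensor_mul _ _ _ (el_mem _) hc.mem_gr',
      gradedTensor_mul _ _ _ (elz_mem _) hc.mem_gr', CoordAlg.el_mul_el, CoordAlg.el_mul_elz,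
      CoordAlg.elz_mul_el, CoordAlg.elz_mul_elz, TensorProduct.tmul_zero, map_zero, smul_zero,
      add_zero, TensorProduct.add_tmul]
    simp only [Units.smul_def, ← TensorProduct.smul_tmul', map_zsmul, zero_mul, one_mul,
      uzpow_zero, Units.val_one, one_smul, ← mul_assoc, mul_right_comm _ P.g, e, ofMul_mul, map_add,
      add_smul, smul_add]
    -- The two terms in `a' * c'` have signs `(-1)^(j+1)` and `(-1)^j` and cancel; the terms in `a *
    -- c` add up by `x(hk) = x(h) + x(k)`.
    rcases CoordAlg.zmod2_cases j with rfl | rfl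
    · simp
      abel
    · simp [show (1 : ZMod 2) + 1 = 0 from rfl]
      abel

theorem isInvariant {i : ZMod 2} {d : ℕ} {a : SuperPoly F b.parity}
    (ha : M.IsWeightPair b 1 i d a 0) : M.IsInvariant b a := by
  rw [IsInvariant, ha.coact, TensorProduct.zero_tmul, add_zero]
  rfl

end IsWeightPair

/-- Applying a functional to the coefficients of `τ(x_i)` and then coacting applies it to the right
factor of `Δ` of these coefficients, where the two coefficient formulas take over. -/
theorem weightPair_X (hg : P.g ^ 2 = 1) (h : X) (i : ι) :
    M.IsWeightPair b h (b.parity i) 1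
      (∑ k, CoordAlg.evenCoeff P h (M.dualCoef b k i) • SuperPoly.X F b.parity k)
      (∑ k, CoordAlg.oddCoeff P (h * P.g) (M.dualCoef b k i) • SuperPoly.X F b.parity k) where
  mem_gr := sum_mem fun k _ => by
    by_cases hk : b.parity i = b.parity k
    · rw [hk]
      exact Submodule.smul_mem _ _ (SuperPoly.X_mem F b.parity k)
    -- Between basis elements of different parity the coefficient is odd, so it has no component at
    -- `h`.
    · rw [CoordAlg.evenCoeff_of_mem P (M.dualCoef_mem b k i), zero_smul]
      · exact zero_mem _
      · revert hk
        generalize b.parity i = s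
        generalize b.parity k = t
        revert s t
        decide
  mem_gr' := sum_mem fun k _ => by
    by_cases hk : b.parity k = b.parity i + 1
    · rw [← hk]
      exact Submodule.smul_mem _ _ (SuperPoly.X_mem F b.parity k)
    · rw [CoordAlg.oddCoeff_of_mem P (M.dualCoef_mem b k i), zero_smul]
      · exact zero_mem _
      · revert hk
        generalize b.parity i = s
        generalize b.parity k = t
        revert s t
        decide
  mem_degPart := sum_mem fun k _ => Submodule.smul_mem _ _ (SuperPoly.X_mem_degPart F b.parity k)
  mem_degPart' := sum_mem fun k _ => Submodule.smul_mem _ _ (SuperPoly.X_mem_degPart F b.parity k)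
  coact := by
    have e : ∀ k, ∑ l, CoordAlg.evenCoeff P h (M.dualCoef b l i) • M.dualCoef b k l =
        CoordAlg.evenCoeff P h (M.dualCoef b k i) • CoordAlg.el P h +
          CoordAlg.oddCoeff P (h * P.g) (M.dualCoef b k i) • CoordAlg.elz P (h * P.g) := fun k => by
      rw [← CoordAlg.rid_comul_evenCoeff P hg, M.comul_dualCoef]
      simp
    simp only [map_sum, map_smul, polyCoact, SuperPoly.lift_X, Finset.smul_sum]
    rw [Finset.sum_comm]
    simp only [← map_smul, ← map_sum, ← TensorProduct.tmul_smul, ← TensorProduct.tmul_sum, e]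
    simp only [TensorProduct.tmul_add, TensorProduct.tmul_smul, TensorProduct.sum_tmul,
      Finset.sum_add_distrib, TensorProduct.smul_tmul']
  coact' := by
    have e : ∀ k, ∑ l, CoordAlg.oddCoeff P (h * P.g) (M.dualCoef b l i) • M.dualCoef b k l =
        CoordAlg.oddCoeff P (h * P.g) (M.dualCoef b k i) • CoordAlg.el P (h * P.g) +
          (P.x (Additive.ofMul h) * CoordAlg.evenCoeff P h (M.dualCoef b k i)) •
            CoordAlg.elz P h := fun k => by
      rw [← CoordAlg.rid_comul_oddCoeff P, M.comul_dualCoef]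
      simp
    simp only [map_sum, map_smul, polyCoact, SuperPoly.lift_X, Finset.smul_sum]
    rw [Finset.sum_comm]
    simp only [← map_smul, ← map_sum, ← TensorProduct.tmul_smul, ← TensorProduct.tmul_sum, e]
    simp only [TensorProduct.tmul_add, TensorProduct.tmul_smul, TensorProduct.sum_tmul,
      Finset.sum_add_distrib, TensorProduct.smul_tmul', Finset.smul_sum, smul_smul]

theorem counit_dualCoef [DecidableEq ι] (k i : ι) :
    Coalgebra.counit (R := F) (M.dualCoef b k i) = if k = i then 1 else 0 := by
  have e : ∀ a, Coalgebra.counit (R := F) ((CoordAlg.hopf P).antipode a) =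
      Coalgebra.counit (R := F) a := fun a => by
    change Coalgebra.counit (R := F) (CoordAlg.antipodeLin P a) = _
    induction a using CoordAlg.induction with
    | h1 h => simp
    | h2 h => simp
    | h3 a b ha hb => simp only [map_add, ha, hb]
    | h4 c a ha => simp only [map_smul, ha]
  rw [dualCoef, Units.smul_def, map_zsmul, e, counit_coef]
  by_cases hk : k = i
  · subst hk
    -- On the diagonal the sign exponent contains a parity added to itself, which is zero in `ZMod
    -- 2`.
    simp [CharTwo.add_self_eq_zero]
  · simp [hk, Ne.symm hk]

/-- The span of the weight vectors of degree `d` which are homogeneous for the parity. -/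
def weightSpan (d : ℕ) : Submodule F (SuperPoly F b.parity) :=
  Submodule.span F {a | ∃ h i a', M.IsWeightPair b h i d a a'}

theorem X_mem_weightSpan (hg : P.g ^ 2 = 1) (i : ι) :
    SuperPoly.X F b.parity i ∈ M.weightSpan b 1 := by
  classical
  -- Counitality recovers `x_i` as the sum of its components of weight `h`, over a finite set of `h`
  -- common to all `k`.
  choose S hS using fun k => CoordAlg.exists_counit_eq_sum P (M.dualCoef b k i)
  have e : SuperPoly.X F b.parity i = ∑ h ∈ Finset.univ.biUnion S,
      ∑ k, CoordAlg.evenCoeff P h (M.dualCoef b k i) • SuperPoly.X F b.parity k := by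
    rw [Finset.sum_comm]
    simp only [← Finset.sum_smul, ← hS _ _ (Finset.subset_biUnion_of_mem S (Finset.mem_univ _)),
      M.counit_dualCoef b]
    simp
  rw [e]
  exact sum_mem fun h _ => Submodule.subset_span ⟨_, _, _, M.weightPair_X b hg h i⟩

theorem degPart_le_weightSpan (hg : P.g ^ 2 = 1) (d : ℕ) :
    SuperPoly.degPart F b.parity d ≤ M.weightSpan b d := by
  rw [SuperPoly.degPart, Submodule.span_le]
  rintro _ ⟨L, rfl, rfl⟩
  induction L with
  | nil => exact Submodule.subset_span ⟨_, _, _, IsWeightPair.one⟩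
  | cons i L ih =>
    have h : M.weightSpan b 1 * M.weightSpan b L.length ≤ M.weightSpan b (1 + L.length) := by
      rw [weightSpan, weightSpan, Submodule.span_mul_span, Submodule.span_le]
      rintro _ ⟨_, ⟨h, i, a', ha⟩, _, ⟨k, j, c', hc⟩, rfl⟩
      exact Submodule.subset_span ⟨_, _, _, ha.mul hg hc⟩
    rw [SuperPoly.word_cons, List.length_cons, add_comm]
    exact h (Submodule.mul_mem_mul (M.X_mem_weightSpan b hg i) ih)

end Supermodule

/-! ### The characters of `D'`, and connectedness of `D`. -/

namespace SuperPair

variable {F X : Type*} [Field F] [CommGroup X] (P : SuperPair F X)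

/-- The homomorphism from `F[D'] = FX / FX(g - 1)` to the group algebra of `X / ⟨g⟩`. -/
def kerCoordHom : P.KerCoord →ₐ[F] MonoidAlgebra F (X ⧸ Subgroup.zpowers P.g) :=
  Ideal.Quotient.liftₐ P.kerIdeal
    (MonoidAlgebra.mapDomainAlgHom F F (QuotientGroup.mk' (Subgroup.zpowers P.g))) (by
      have h : P.kerIdeal ≤ RingHom.ker (MonoidAlgebra.mapDomainAlgHom F F
          (QuotientGroup.mk' (Subgroup.zpowers P.g))) := by
        rw [kerIdeal, Ideal.span_le, Set.singleton_subset_iff]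
        change MonoidAlgebra.mapDomainAlgHom F F _ _ = 0
        have e : (QuotientGroup.mk' (Subgroup.zpowers P.g)) P.g = 1 :=
          (QuotientGroup.eq_one_iff _).mpr (Subgroup.mem_zpowers P.g)
        rw [map_sub, map_one]
        change MonoidAlgebra.mapDomain _ (MonoidAlgebra.single P.g (1 : F)) - 1 = 0
        rw [MonoidAlgebra.mapDomain_single]
        exact sub_eq_zero.mpr (congrArg (MonoidAlgebra.single · (1 : F)) e)
      exact fun a ha => h ha)

/-- The linear form on `F[D']` which takes the value `1` at `h ∈ ⟨g⟩` and `0` at `h ∉ ⟨g⟩`. -/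
def kerCoordForm : P.KerCoord →ₗ[F] F :=
  Finsupp.lapply 1 ∘ₗ (MonoidAlgebra.coeffLinearEquiv F).toLinearMap ∘ₗ P.kerCoordHom.toLinearMap

theorem kerCoordForm_mk (h : X) [Decidable (h ∈ Subgroup.zpowers P.g)] :
    P.kerCoordForm (Ideal.Quotient.mk P.kerIdeal (MonoidAlgebra.single h 1)) =
      if h ∈ Subgroup.zpowers P.g then 1 else 0 := by
  classical
  have e : P.kerCoordHom (Ideal.Quotient.mk P.kerIdeal (MonoidAlgebra.single h 1)) =
      MonoidAlgebra.single (h : X ⧸ Subgroup.zpowers P.g) 1 := by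
    change MonoidAlgebra.mapDomainAlgHom F F (QuotientGroup.mk' (Subgroup.zpowers P.g))
      (MonoidAlgebra.single h 1) = _
    simp
  have : P.kerCoordForm (Ideal.Quotient.mk P.kerIdeal (MonoidAlgebra.single h 1)) =
      Finsupp.single (h : X ⧸ Subgroup.zpowers P.g) (1 : F) 1 :=
    congrArg (fun a => MonoidAlgebra.coeff a 1) e
  rw [this, Finsupp.single_apply]
  exact if_congr (QuotientGroup.eq_one_iff h) rfl rfl

theorem kerCoordForm_one : P.kerCoordForm 1 = 1 := by
  classical
  have := P.kerCoordForm_mk 1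
  rwa [← MonoidAlgebra.one_def, map_one, if_pos (one_mem _)] at this

/-- Since `g² = 1` and `2` is invertible, `(1 + g)/2` is an idempotent of `FX`; connectedness forces
it to be `0` or `1`. -/
theorem g_eq_one_of_connectedSpace [NeZero (2 : F)] (hg : P.g ^ 2 = 1)
    (h : ConnectedSpace (PrimeSpectrum (MonoidAlgebra F X))) : P.g = 1 := by
  classical
  by_contra hne
  have h2 : (2 : F) ≠ 0 := NeZero.ne 2
  set u : MonoidAlgebra F X := MonoidAlgebra.single P.g 1 with hu
  have huu : u * u = 1 := by
    rw [hu, MonoidAlgebra.single_mul_single, ← pow_two, hg, mul_one, MonoidAlgebra.one_def]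
  set e : MonoidAlgebra F X := (2 : F)⁻¹ • (1 + u) with he
  have hi : IsIdempotentElem e := by
    rw [IsIdempotentElem, he, smul_mul_smul_comm, mul_add, add_mul, add_mul, huu, one_mul, mul_one,
      one_mul, show (1 : MonoidAlgebra F X) + u + (u + 1) = (2 : F) • (1 + u) by
        rw [two_smul]; abel, smul_smul, mul_assoc, inv_mul_cancel₀ h2, mul_one]
  have key : e = 0 ∨ e = 1 := by
    rcases isClopen_iff.mp (PrimeSpectrum.isClopen_iff.mpr ⟨e, hi, rfl⟩) with h | h
    · exact Or.inl (PrimeSpectrum.basicOpen_injOn_isIdempotentElem hi IsIdempotentElem.zero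
        (TopologicalSpace.Opens.ext (by simpa using h)))
    · exact Or.inr (PrimeSpectrum.basicOpen_injOn_isIdempotentElem hi IsIdempotentElem.one
        (TopologicalSpace.Opens.ext (by simpa using h)))
  -- If `g ≠ 1`, both `0` and `1` have coefficient `0` at `g`, which contradicts this value.
  have c : MonoidAlgebra.coeff e P.g = (2 : F)⁻¹ := by
    simp [he, hu, MonoidAlgebra.one_def, Finsupp.single_apply, Ne.symm hne]
  rcases key with h | h
  · rw [h] at c
    exact inv_ne_zero h2 (by simpa using c.symm)
  · rw [h] at c
    refine inv_ne_zero h2 ?_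
    simpa [MonoidAlgebra.one_def, Finsupp.single_apply, Ne.symm hne] using c.symm

end SuperPair

/-! ### The upper bounds in the two cases. -/

namespace Supermodule

variable {F X V ι : Type*} [Field F] [NeZero (2 : F)] [CommGroup X]
  [AddCommGroup V] [Module F V] [Fintype ι] {P : SuperPair F X}
  (M : Supermodule (CoordAlg.hopf P) V) (b : HomogBasis M.gr ι)

theorem x_g_eq_zero (P : SuperPair F X) : P.x (Additive.ofMul P.g) = 0 := by
  rcases CoordAlg.g_cases P with h | h
  · rw [h, AddMonoidHom.zero_apply]
  · exact h.2

variable {M b}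

/-- If a non-zero invariant of `D'` is a linear combination of weight vectors, then one of these
has a weight in `⟨g⟩`, that is, a weight which is trivial on `D'`. -/
theorem exists_mem_zpowers_of_isInvariant {S : Set (X × SuperPoly F b.parity)}
    (hS : ∀ s ∈ S, ∃ i d a', M.IsWeightPair b s.1 i d s.2 a') {f : SuperPoly F b.parity}
    (hf : f ∈ Submodule.span F (Prod.snd '' S)) (hf0 : f ≠ 0)
    (hi : M.restrictKer.IsInvariant b f) :
    ∃ s ∈ S, s.2 ≠ 0 ∧ s.1 ∈ Subgroup.zpowers P.g := by
  classical
  by_contra! hcon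
  -- The projection onto the weights trivial on `D'`: it fixes every `D'`-invariant and kills weight
  -- vectors whose weight lies outside `⟨g⟩`.
  let E : SuperPoly F b.parity →ₗ[F] SuperPoly F b.parity :=
    (TensorProduct.rid F _).toLinearMap ∘ₗ P.kerCoordForm.lTensor _ ∘ₗ
      (GradedTensorProduct.of F (SuperPoly.gr F b.parity) P.kerHopf.gr).symm.toLinearMap ∘ₗ
      (M.restrictKer.polyCoact b).toLinearMap
  have h1 : E f = f := by
    change TensorProduct.rid F _ (P.kerCoordForm.lTensor _ ((GradedTensorProduct.of F
      (SuperPoly.gr F b.parity) P.kerHopf.gr).symm (M.restrictKer.polyCoact b f))) = f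
    have hi' : M.restrictKer.polyCoact b f =
      GradedTensorProduct.of F (SuperPoly.gr F b.parity) P.kerHopf.gr (f ⊗ₜ 1) := hi
    rw [hi', GradedTensorProduct.of_symm_of, LinearMap.lTensor_tmul, P.kerCoordForm_one,
      TensorProduct.rid_tmul, one_smul]
  have h2 : Submodule.span F (Prod.snd '' S) ≤ LinearMap.ker E := by
    rw [Submodule.span_le]
    rintro _ ⟨⟨h, a⟩, hs, rfl⟩
    obtain ⟨i, d, a', ha⟩ := hS _ hs
    change TensorProduct.rid F _ (P.kerCoordForm.lTensor _ ((GradedTensorProduct.of F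
      (SuperPoly.gr F b.parity) P.kerHopf.gr).symm (M.restrictKer.polyCoact b a))) = 0
    have e0 : P.restrictHom (CoordAlg.el P h) =
      Ideal.Quotient.mk P.kerIdeal (MonoidAlgebra.single h 1) := P.restrictAlgHom_el h
    have e1 : P.restrictHom (CoordAlg.elz P (h * P.g)) = 0 := P.restrictAlgHom_elz _
    rw [restrictKer_polyCoact, ha.coact, map_add, map_add, restrictTensor_of, restrictTensor_of,
      e1, TensorProduct.tmul_zero, map_zero, add_zero, GradedTensorProduct.of_symm_of, e0,
      LinearMap.lTensor_tmul, P.kerCoordForm_mk, TensorProduct.rid_tmul]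
    by_cases h0 : a = 0
    · rw [h0, smul_zero]
    · rw [if_neg (hcon _ hs h0), zero_smul]
  exact hf0 (h1 ▸ h2 hf)

/-- The second term of `τ(a')` carries the factor `x(g) = 0`, and the first is `a' ⊗ g² = a' ⊗ 1`.
-/
theorem IsWeightPair.isInvariant_snd (hg : P.g ^ 2 = 1) {i : ZMod 2} {d : ℕ}
    {a a' : SuperPoly F b.parity} (ha : M.IsWeightPair b P.g i d a a') :
    M.IsInvariant b a' := by
  rw [IsInvariant, ha.coact', x_g_eq_zero, zero_smul, add_zero, ← pow_two, hg]
  rfl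

theorem minDeg_le_of_g_eq_one (hg : P.g = 1) : M.minDeg b ≤ M.restrictKer.minDeg b := by
  have hg2 : P.g ^ 2 = 1 := by rw [hg, one_pow]
  refine le_iInf₂ fun d ⟨hd, f, hf, hf0, hi⟩ => iInf₂_le d ⟨hd, ?_⟩
  obtain ⟨⟨h, a⟩, ⟨i, a', ha⟩, ha0, hh⟩ := exists_mem_zpowers_of_isInvariant
    (S := {s | ∃ i a', M.IsWeightPair b s.1 i d s.2 a'})
    (fun s ⟨i, a', hs⟩ => ⟨i, d, a', hs⟩)
    (Submodule.span_mono (by rintro a ⟨h, i, a', ha⟩; exact ⟨(h, a), ⟨i, a', ha⟩, rfl⟩)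
      (M.degPart_le_weightSpan b hg2 d hf)) hf0 hi
  rw [hg, Subgroup.zpowers_one_eq_bot, Subgroup.mem_bot] at hh
  dsimp only at ha ha0 hh
  subst hh
  -- Here `a` has weight `1`, which is also `g`: it is invariant itself, or else its companion is a
  -- non-zero invariant.
  by_cases h0 : a' = 0
  · exact ⟨a, ha.mem_degPart, ha0, (h0 ▸ ha).isInvariant⟩
  · exact ⟨a', ha.mem_degPart', h0, (hg.symm ▸ ha : M.IsWeightPair b P.g i d a a').isInvariant_snd
      hg2⟩

theorem exists_isWeightPair_word (hg : P.g ^ 2 = 1) {w : ι → X}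
    (hw : ∀ i, ∃ a', M.IsWeightPair b (w i) (b.parity i) 1 (SuperPoly.X F b.parity i) a')
    (L : List ι) : ∃ a', M.IsWeightPair b (L.map w).prod (L.map b.parity).sum L.length
      (SuperPoly.word F b.parity L) a' := by
  induction L with
  | nil => exact ⟨0, IsWeightPair.one⟩
  | cons i L ih =>
    obtain ⟨a', ha⟩ := hw i
    obtain ⟨c', hc⟩ := ih
    rw [List.map_cons, List.prod_cons, List.map_cons, List.sum_cons, SuperPoly.word_cons,
      List.length_cons, add_comm L.length]
    exact ⟨_, ha.mul hg hc⟩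

/-- Doubling commutes with infima in `ℕ∞`, including the empty one, so the value `∞` needs no
separate treatment. -/
theorem le_two_mul_minDeg_restrictKer {n : ℕ∞} (H : ∀ d : ℕ, 0 < d →
    ∀ f ∈ SuperPoly.degPart F b.parity d, f ≠ 0 → M.restrictKer.IsInvariant b f → n ≤ 2 * d) :
    n ≤ 2 * M.restrictKer.minDeg b := by
  change n ≤ 2 * ⨅ (d : ℕ) (_ : 0 < d ∧ ∃ f ∈ SuperPoly.degPart F b.parity d,
    f ≠ 0 ∧ M.restrictKer.IsInvariant b f), (d : ℕ∞)
  rw [ENat.mul_iInf_of_ne two_ne_zero]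
  refine le_iInf fun d => ?_
  rw [ENat.mul_iInf_of_ne two_ne_zero]
  exact le_iInf fun ⟨hd, f, hf, hf0, hi⟩ => H d hd f hf hf0 hi

theorem minDeg_le_of_dualIsSumL (hg : P.g ^ 2 = 1) (hL : M.DualIsSumL b) :
    M.minDeg b ≤ 2 * M.restrictKer.minDeg b := by
  classical
  obtain ⟨s, e, h, H⟩ := hL
  have hgg : ∀ k : X, k * P.g * P.g = k := fun k => by rw [mul_assoc, ← pow_two, hg, mul_one]
  have hw0 : ∀ j, M.IsWeightPair b (h j) (b.parity (e (j, 0))) 1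
      (SuperPoly.X F b.parity (e (j, 0)))
      (P.x (Additive.ofMul (h j)) • SuperPoly.X F b.parity (e (j, 1))) := fun j => by
    obtain ⟨p0, p1, t0, t1⟩ := H j
    have m := SuperPoly.X_mem F b.parity (e (j, 1))
    refine ⟨SuperPoly.X_mem F _ _, Submodule.smul_mem _ _ (by rwa [p0, zero_add, ← p1]),
      SuperPoly.X_mem_degPart F _ _, Submodule.smul_mem _ _ (SuperPoly.X_mem_degPart F _ _), ?_, ?_⟩
    · rw [t0, TensorProduct.smul_tmul']
    · rw [map_smul, t1, ← map_smul, smul_add, add_comm, TensorProduct.smul_tmul']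
  have hw1 : ∀ j, M.IsWeightPair b (h j * P.g) (b.parity (e (j, 1))) 1
      (SuperPoly.X F b.parity (e (j, 1))) (SuperPoly.X F b.parity (e (j, 0))) := fun j => by
    obtain ⟨p0, p1, t0, t1⟩ := H j
    have m := SuperPoly.X_mem F b.parity (e (j, 0))
    refine ⟨SuperPoly.X_mem F _ _, ?_, SuperPoly.X_mem_degPart F _ _,
      SuperPoly.X_mem_degPart F _ _, ?_, ?_⟩
    · rw [p0] at m
      rwa [p1]
    · rw [t1, hgg, add_comm]
    · rw [t0, hgg, ofMul_mul, P.x.map_add, x_g_eq_zero, add_zero]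
  -- The generators themselves are weight vectors, `f_{j,t}` having weight `h_j g^t`; hence so are
  -- all words.
  have hw : ∀ i, ∃ a', M.IsWeightPair b (h (e.symm i).1 * P.g ^ ((e.symm i).2 : ℕ)) (b.parity i) 1
      (SuperPoly.X F b.parity i) a' := fun i => by
    obtain ⟨⟨j, t⟩, rfl⟩ := e.surjective i
    rw [Equiv.symm_apply_apply]
    fin_cases t
    · simpa using ⟨_, hw0 j⟩
    · simpa using ⟨_, hw1 j⟩
  refine le_two_mul_minDeg_restrictKer fun d hd f hf hf0 hi => ?_
  -- Taking words as the spanning weight vectors makes the vector of weight in `⟨g⟩` an explicit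
  -- word `L`.
  obtain ⟨_, ⟨L, rfl, rfl⟩, -, hL⟩ := exists_mem_zpowers_of_isInvariant
    (S := (fun L => ((L.map fun i => h (e.symm i).1 * P.g ^ ((e.symm i).2 : ℕ)).prod,
      SuperPoly.word F b.parity L)) '' {L | L.length = d})
    (by
      rintro _ ⟨L, -, rfl⟩
      exact ⟨_, _, exists_isWeightPair_word hg hw L⟩)
    (by rwa [Set.image_image]) hf0 hi
  set K : List (Fin s) := L.map fun i => (e.symm i).1 with hK
  -- `K` records the indices `j` of the letters. Its weight differs from that of `L` by a power of
  -- `g`, so it lies in `⟨g⟩` too and its square is `1`. This doubling is the source of the factor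
  -- `2`.
  have hsq : ((K ++ K).map h).prod = 1 := by
    obtain ⟨n, hn⟩ := Subgroup.mem_zpowers_iff.mp hL
    have h1 : ∀ L : List ι, ((L.map fun i => (e.symm i).1).map h).prod ^ 2 =
        (L.map fun i => h (e.symm i).1 * P.g ^ ((e.symm i).2 : ℕ)).prod ^ 2 := fun L => by
      induction L with
      | nil => rfl
      | cons i L ih =>
        rw [List.map_cons, List.map_cons, List.map_cons, List.prod_cons, List.prod_cons, mul_pow,
          mul_pow, ih, mul_pow, ← pow_mul, mul_comm _ 2, pow_mul, hg, one_pow, mul_one]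
    rw [List.map_append, List.prod_append, ← pow_two, hK, h1]
    dsimp only at hn
    rw [← hn, ← zpow_natCast, ← zpow_mul, mul_comm, zpow_mul, zpow_natCast, hg, one_zpow]
  have hlen : (K ++ K).length = 2 * L.length := by
    rw [List.length_append, hK, List.length_map, two_mul]
  generalize K ++ K = N at hsq hlen
  -- The doubled word is non-empty because `d > 0`, so it has a first letter `j` to be made odd.
  obtain _ | ⟨j, R⟩ := N
  · rw [List.length_nil] at hlen
    omega
  rw [List.map_cons, List.prod_cons] at hsq
  obtain ⟨c', hc⟩ := exists_isWeightPair_word hg hw (R.map fun j => e (j, 0))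
  have hwR : ((R.map fun j => e (j, 0)).map fun i =>
      h (e.symm i).1 * P.g ^ ((e.symm i).2 : ℕ)).prod = (R.map h).prod := by
    simp [Function.comp_def]
  have hpR : ((R.map fun j => e (j, 0)).map b.parity).sum = 0 := by
    simp [Function.comp_def, (H _).1]
  rw [hwR, hpR] at hc
  -- The odd partner of the first letter times the even word of `R` has weight `g`, so its companion
  -- will be invariant.
  have hu := (hw1 j).mul hg hc
  rw [mul_right_comm, hsq, one_mul] at hu
  rw [uzpow_zero, one_smul] at hu
  have hdeg : 1 + (R.map fun j => e (j, 0)).length = 2 * L.length := by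
    rw [← hlen, List.length_map, List.length_cons, add_comm]
  rw [hdeg] at hu
  have hne : SuperPoly.X F b.parity (e (j, 1)) * c' + SuperPoly.X F b.parity (e (j, 0)) *
      SuperPoly.word F b.parity (R.map fun j => e (j, 0)) ≠ 0 := fun h0 => by
    -- Modulo the odd generators the first summand, with its unknown factor `c'`, disappears and the
    -- full even word survives.
    have h1 := congrArg (SuperPoly.evenHom F b.parity) h0
    rw [map_add, map_mul, SuperPoly.evenHom_X_odd F _ (H j).2.1, zero_mul, zero_add,
      ← SuperPoly.word_cons, map_zero] at h1
    refine SuperPoly.evenHom_word_ne_zero F b.parity _ (fun i hi => ?_) h1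
    rcases List.mem_cons.mp hi with rfl | hi
    · exact (H j).1
    · obtain ⟨k, -, rfl⟩ := List.mem_map.mp hi
      exact (H k).1
  have hle : M.minDeg b ≤ ((2 * L.length : ℕ) : ℕ∞) :=
    iInf₂_le (2 * L.length) ⟨by omega, _, hu.mem_degPart', hne, hu.isInvariant_snd hg⟩
  exact_mod_cast hle

end Supermodule
end

theorem mainTheorem1 {F X V ι : Type*} [Field F] [NeZero (2 : F)] [CommGroup X]
    [AddCommGroup V] [Module F V] [Fintype ι] (P : SuperPair F X) (hg : P.g ^ 2 = 1)
    (M : Supermodule (CoordAlg.hopf P) V) (b : HomogBasis M.gr ι) :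
    (ConnectedSpace (PrimeSpectrum (MonoidAlgebra F X)) →
      M.restrictKer.minDeg b ≤ M.minDeg b ∧ M.minDeg b ≤ 2 * M.restrictKer.minDeg b) ∧
    (M.DualIsSumL b →
      M.restrictKer.minDeg b ≤ M.minDeg b ∧ M.minDeg b ≤ 2 * M.restrictKer.minDeg b) := by
  refine ⟨fun h => ⟨M.restrictKer_minDeg_le b, ?_⟩,
    fun h => ⟨M.restrictKer_minDeg_le b, Supermodule.minDeg_le_of_dualIsSumL hg h⟩⟩
  -- In the connected case the bound holds even without the factor `2`.
  rw [two_mul]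
  exact (Supermodule.minDeg_le_of_g_eq_one (P.g_eq_one_of_connectedSpace hg h)).trans
    le_self_add
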